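/- Let $\Sigma$ be a finite alphabet of size $\sigma\ge 2$. For a string $S=S[1]\cdots S[n]$ over $\Sigma$, a factor is a string $S[i,j]=S[i]\cdots S[j]$ with $1\le i\le j\le n$. A border of a string is a non-empty prefix that is also a suffix, and a string is unbordered if it has no border other than itself. $L(S)$ is the maximum length of an unbordered factor of $S$ (with $L=0$ for the empty string), and $\operatorname{per}(S)$ is the shortest period of $S$, i.e. the least integer $p>0$ with $S[i]=S[i+p]$ for all $1\le i\le n-p$. Running times are unit-cost running times of a word RAM with words of $O(\log(n+\sigma))$ bits, which receives $n$ and $\sigma$, accesses the symbols of $S$ only by testing whether $S[x]=S[y]$ for given positions $x,y$, and has an oracle instruction of unit cost. The programs below are deterministic and always correct; the expectation is over the uniformly random input $S\in\Sigma^n$. (a) There is a single program and an absolute constant $C$ such that for all $\sigma\ge2$ and $n\ge 1$ there is a factor $S'=S[i,j]$, whose endpoints $1\le i\le j\le n$ depend on $n$ and $\sigma$ only, for which the following holds: on every $S\in\Sigma^n$ the program makes exactly one oracle query, for the value $\operatorname{per}(S')$, and outputs $L(S)$; and for uniformly random $S\in\Sigma^n$ its expected running time is at most $C(1+\log_\sigma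 n)$. (b) There is a single program and an absolute constant $C$ such that for all $\sigma\ge2$ and $n\ge1$: on every $S\in\Sigma^n$ the program makes exactly one oracle query, for the value $L(S)$, and outputs $\operatorname{per}(S)$; and for uniformly random $S\in\Sigma^n$ its expected running time is at most $C$. (c) Let $S$ be a string of length $n$ over any alphabet and let $d\ge 0$ be an integer with $n>6d$. Put $\bar S=S[1,3d]\,S[n-3d+1,n]$, $S'=S[d+1,n-d]$ and $\bar S'=S[d+1,3d]\,S[n-3d+1,n-d]$. If $|\bar S|-L(\bar S)\le d$, $|S'|-\operatorname{per}(S')\le d$ and $|\bar S'|-\operatorname{per}(\bar S')\le d$, then $|S|-L(S)=|\bar S|-L(\bar S)$. (d) Let $S$ be a non-empty string of length $n$ over any alphabet and let $S_\$=S[1,n-L(S)]\,\$\,S[L(S)+1,n]$, where $\$$ is a symbol outside of the alphabet. Then $|S|-\operatorname{per}(S)=|S_\$|-\operatorname{per}(S_\$)$. -/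

import Mathlib

universe u

/-! ### Strings

Strings over an alphabet `A` are lists; positions are counted from `0`. -/

namespace Str

variable {A : Type u}

/-- The factor of `w` that occupies the positions `i, i + 1, …, j - 1`. -/
def factor (w : List A) (i j : ℕ) : List A := (w.take j).drop i

/-- `b` is a border of `w`: a non-empty prefix of `w` that is also a suffix of `w`. -/
def IsBorder (b w : List A) : Prop := b ≠ [] ∧ b <+: w ∧ b <:+ w

/-- `w` is unbordered: it has no border other than itself. -/
def Unbordered (w : List A) : Prop := ∀ b, IsBorder b w → b = w

/-- `L(w)`: the maximum length of an unbordered (non-empty) factor of `w`; it is `0` for the empty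
string. -/
noncomputable def maxUnbordered (w : List A) : ℕ :=
  sSup {m | ∃ f, f ≠ [] ∧ f <:+: w ∧ Unbordered f ∧ f.length = m}

/-- `per(w)`: the shortest period of `w`. -/
noncomputable def shortestPeriod (w : List A) : ℕ :=
  sInf {p | 0 < p ∧ w.HasPeriod p}

/-- The string made of the first `m` symbols of `w`, a sentinel symbol outside of the alphabet
(`none`), and the last `m` symbols of `w`. -/
def withSentinel (w : List A) (m : ℕ) : List (Option A) :=
  (w.take m).map some ++ none :: (w.drop (w.length - m)).map some

end Str

/-! ### A random access machine with an oracle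

Structured programs for a unit-cost word RAM. The store consists of variables and of an array
`mem`; every cell holds a natural number below the word bound `W`. The input string is accessed
only through equality tests between its symbols and through an oracle instruction, which returns
the value of a fixed string function on a factor of the input. -/

namespace RAM

/-- Contents of the store. -/
structure Store where
  /-- the variables -/
  vars : ℕ → ℕ
  /-- the array -/
  mem : ℕ → ℕ

/-- Arithmetic expressions. -/
inductive Exp where
  /-- a constant -/
  | lit (c : ℕ)
  /-- the value of a variable -/
  | var (x : ℕ)
  /-- the array cell at a computed address -/
  | load (a : Exp)
  | add (e f : Exp)
  /-- truncated subtraction -/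
  | sub (e f : Exp)
  | mul (e f : Exp)
  /-- integer division (`0` if the divisor is `0`) -/
  | div (e f : Exp)

/-- The value of an expression. -/
def Exp.eval (s : Store) : Exp → ℕ
  | lit c => c
  | var x => s.vars x
  | load a => s.mem (a.eval s)
  | add e f => e.eval s + f.eval s
  | sub e f => e.eval s - f.eval s
  | mul e f => e.eval s * f.eval s
  | div e f => e.eval s / f.eval s

/-- The number of operations of an expression. -/
def Exp.cost : Exp → ℕ
  | lit _ => 1
  | var _ => 1
  | load a => a.cost + 1
  | add e f => e.cost + f.cost + 1
  | sub e f => e.cost + f.cost + 1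
  | mul e f => e.cost + f.cost + 1
  | div e f => e.cost + f.cost + 1

/-- Tests. -/
inductive Test where
  | lt (e f : Exp)
  | eq (e f : Exp)
  /-- do two positions of the input string carry the same symbol? -/
  | symEq (e f : Exp)
  | not (t : Test)
  | and (t r : Test)

/-- The truth value of a test on the input string `S`. -/
def Test.Holds {A : Type u} (S : List A) (s : Store) : Test → Prop
  | lt e f => e.eval s < f.eval s
  | eq e f => e.eval s = f.eval s
  | symEq e f => ∃ a, S[e.eval s]? = some a ∧ S[f.eval s]? = some a
  | not t => ¬ t.Holds S s
  | and t r => t.Holds S s ∧ r.Holds S s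

/-- The number of operations of a test. -/
def Test.cost : Test → ℕ
  | lt e f => e.cost + f.cost + 1
  | eq e f => e.cost + f.cost + 1
  | symEq e f => e.cost + f.cost + 1
  | not t => t.cost + 1
  | and t r => t.cost + r.cost + 1

/-- Programs. -/
inductive Prog where
  | skip
  /-- assign the value of `e` to the variable `x` -/
  | assign (x : ℕ) (e : Exp)
  /-- write the value of `e` to the array cell at the address `a` -/
  | store (a e : Exp)
  /-- ask the oracle about the factor of the input at the positions `i, …, j - 1`, and assign the
  answer to the variable `x` -/
  | query (x : ℕ) (i j : Exp)
  | seq (P Q : Prog)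
  | ite (t : Test) (P Q : Prog)
  | loop (t : Test) (P : Prog)

/-- `Exec W S O P s s' t q`: with word bound `W`, on the input string `S` and with the oracle `O`,
the program `P` started in the store `s` halts in the store `s'` after `t` steps, and `q` lists
the factors (start, end) that the oracle was asked about, in order. A word overflow or a query
about something that is not a factor of `S` is an error: then there is no such run. -/
inductive Exec {A : Type u} (W : ℕ) (S : List A) (O : List A → ℕ) :
    Prog → Store → Store → ℕ → List (ℕ × ℕ) → Prop where
  | skip (s : Store) : Exec W S O .skip s s 1 []
  | assign (x : ℕ) (e : Exp) (s : Store) (h : e.eval s < W) :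
      Exec W S O (.assign x e) s
        { s with vars := Function.update s.vars x (e.eval s) } (e.cost + 1) []
  | store (a e : Exp) (s : Store) (ha : a.eval s < W) (h : e.eval s < W) :
      Exec W S O (.store a e) s
        { s with mem := Function.update s.mem (a.eval s) (e.eval s) } (a.cost + e.cost + 1) []
  | query (x : ℕ) (i j : Exp) (s : Store) (hij : i.eval s < j.eval s) (hj : j.eval s ≤ S.length)
      (h : O (Str.factor S (i.eval s) (j.eval s)) < W) :
      Exec W S O (.query x i j) s
        { s with vars := Function.update s.vars x (O (Str.factor S (i.eval s) (j.eval s))) }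
        (i.cost + j.cost + 1) [(i.eval s, j.eval s)]
  | seq {P Q : Prog} {s s₁ s₂ : Store} {t₁ t₂ : ℕ} {q₁ q₂ : List (ℕ × ℕ)}
      (hP : Exec W S O P s s₁ t₁ q₁) (hQ : Exec W S O Q s₁ s₂ t₂ q₂) :
      Exec W S O (.seq P Q) s s₂ (t₁ + t₂) (q₁ ++ q₂)
  | iteTrue {b : Test} {P Q : Prog} {s s₁ : Store} {t : ℕ} {q : List (ℕ × ℕ)}
      (hb : b.Holds S s) (hP : Exec W S O P s s₁ t q) :
      Exec W S O (.ite b P Q) s s₁ (b.cost + 1 + t) q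
  | iteFalse {b : Test} {P Q : Prog} {s s₁ : Store} {t : ℕ} {q : List (ℕ × ℕ)}
      (hb : ¬ b.Holds S s) (hQ : Exec W S O Q s s₁ t q) :
      Exec W S O (.ite b P Q) s s₁ (b.cost + 1 + t) q
  | loopFalse {b : Test} {P : Prog} {s : Store} (hb : ¬ b.Holds S s) :
      Exec W S O (.loop b P) s s (b.cost + 1) []
  | loopTrue {b : Test} {P : Prog} {s s₁ s₂ : Store} {t₁ t₂ : ℕ} {q₁ q₂ : List (ℕ × ℕ)}
      (hb : b.Holds S s) (hP : Exec W S O P s s₁ t₁ q₁)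
      (hL : Exec W S O (.loop b P) s₁ s₂ t₂ q₂) :
      Exec W S O (.loop b P) s s₂ (b.cost + 1 + t₁ + t₂) (q₁ ++ q₂)

/-- The machine is deterministic: final store, number of steps and queries are unique. -/
theorem Exec.unique {A : Type u} {W : ℕ} {S : List A} {O : List A → ℕ} {P : Prog}
    {s s₁ s₂ : Store} {t₁ t₂ : ℕ} {q₁ q₂ : List (ℕ × ℕ)}
    (h₁ : Exec W S O P s s₁ t₁ q₁) (h₂ : Exec W S O P s s₂ t₂ q₂) :
    s₁ = s₂ ∧ t₁ = t₂ ∧ q₁ = q₂ := by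
  induction h₁ generalizing s₂ t₂ q₂ with
  | skip | assign | store | query => cases h₂; exact ⟨rfl, rfl, rfl⟩
  | seq _ _ ihP ihQ =>
    cases h₂ with
    | seq hP hQ =>
      obtain ⟨rfl, rfl, rfl⟩ := ihP hP
      obtain ⟨rfl, rfl, rfl⟩ := ihQ hQ
      exact ⟨rfl, rfl, rfl⟩
  | iteTrue hb _ ih =>
    cases h₂ with
    | iteTrue _ h => obtain ⟨rfl, rfl, rfl⟩ := ih h; exact ⟨rfl, rfl, rfl⟩
    | iteFalse hb' _ => exact absurd hb hb'
  | iteFalse hb _ ih =>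
    cases h₂ with
    | iteTrue hb' _ => exact absurd hb' hb
    | iteFalse _ h => obtain ⟨rfl, rfl, rfl⟩ := ih h; exact ⟨rfl, rfl, rfl⟩
  | loopFalse hb =>
    cases h₂ with
    | loopFalse _ => exact ⟨rfl, rfl, rfl⟩
    | loopTrue hb' _ _ => exact absurd hb' hb
  | loopTrue hb _ _ ihP ihL =>
    cases h₂ with
    | loopFalse hb' => exact absurd hb hb'
    | loopTrue _ hP hL =>
      obtain ⟨rfl, rfl, rfl⟩ := ihP hP
      obtain ⟨rfl, rfl, rfl⟩ := ihL hL
      exact ⟨rfl, rfl, rfl⟩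

/-- The initial store for inputs of length `n` over an alphabet of size `σ`: variable `0` holds
`n`, variable `1` holds `σ`, and everything else is `0`. -/
def initStore (n σ : ℕ) : Store where
  vars := fun x => if x = 0 then n else if x = 1 then σ else 0
  mem := fun _ => 0

/-- With word bound `W`, on the input `S` over an alphabet of size `σ` and with the oracle `O`, the
program `P` halts after exactly `t` steps with the output `out` (in variable `0`), and it makes
exactly one oracle query, about the factor of `S` at the positions `i, …, j - 1`. -/
def RunsWithOneQuery {A : Type u} (W σ : ℕ) (S : List A) (O : List A → ℕ) (P : Prog)
    (i j out t : ℕ) : Prop :=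
  ∃ s : Store, Exec W S O P (initStore S.length σ) s t [(i, j)] ∧ s.vars 0 = out

end RAM

/-- The mean of `T` over a uniformly random string in `A ^ n`. -/
noncomputable def uniformMean {A : Type u} [Fintype A] (n : ℕ) (T : (Fin n → A) → ℕ) : ℝ :=
  (∑ S : Fin n → A, (T S : ℝ)) / (Fintype.card A : ℝ) ^ n

/-!
Everything is governed by `B = |S| - L(S)`, the number of symbols that have to be omitted at the
ends of `S` to obtain an unbordered factor.

*Combinatorics.* A border of length `l` of a factor of length `m` amounts to its period `m - l`, and
a period passes on to all factors inside. Hence `L(S) ≤ per(S)`, which is all that the sentinel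
construction needs (`Str.length_sub_shortestPeriod_eq`). Conversely, if the factor that omits the
first and last `d` symbols has no border longer than `d`, then a factor of `S` that omits at most
`d` symbols in total has no border longer than `3 d`. So only the first and last `3 d` symbols
matter for the question whether it is unbordered (`Str.length_sub_maxUnbordered_eq`,
`Str.border_le_of_le_shortestPeriod`).

*Probability.* The tail of `B` decays like `σ ^ (-c b)` with an absolute constant `c > 0`, uniformly
in the length of the string (`prob_tail_le`). If `B > b`, then all factors
that omit at most `b` symbols are bordered. A border longer than a fixed fraction of `b` has
exponentially small probability. If the shortest borders are all shorter, then reading them off one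
after the other parses a prefix of `S`, of length proportional to `b`, into unbordered suffixes. For
a prefix of length `m` there are about `2 ^ m` ways to choose the lengths of the parts, against
`σ ^ m` prefixes, which suffices for `σ ≥ 3`. For `σ = 2`, two of the last three symbols of `S` are
equal, so that, possibly after the omission of the last symbol, no unbordered suffix has length `2`,
or none has length `3`; this leaves at most `1.9 ^ m` ways (`prob_parse_le_pow`). It follows that `B`
has a bounded third moment (`exists_mean_cube_le`).

*Programs.* From `L(S)`, the shortest period is found by comparing the prefix and the suffix of the
lengths `B, B - 1, …` symbol by symbol, in time `O((B + 1) ^ 2)` (`RAM.runs_periodProg`). To find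
`L(S)` from the period of an inner factor with margins `d` of order `log_σ n`, the factors that omit
`0, 1, 2, …` symbols are tested for borders in the same way. If the inner factor has no border
longer than `d` and if `B ≤ d`, then only lengths up to `3 d` have to be tested, and each of them takes
constant time on average. Otherwise an exhaustive search takes time `O(n ^ 4)`, but this has
probability `O(n ^ (-4))` (`RAM.runs_unborderedProg`, `exists_mean_searchCost_le`).
-/

namespace Str

variable {A : Type u}

/-! ### Borders and periods by positions -/

/-- The factors of length `r` of `w` that start at the positions `i` and `j` are equal. (Positions
outside of `w` count as carrying a common blank symbol.) -/
def Match (w : List A) (i j r : ℕ) : Prop := ∀ k < r, w[i + k]? = w[j + k]?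

/-- The factor of `w` at the positions `x, …, e - 1` has a border other than itself. -/
def Bordered (w : List A) (x e : ℕ) : Prop :=
  ∃ l, 0 < l ∧ l < e - x ∧ Match w x (e - l) l

theorem Match.sub {w : List A} {i j r : ℕ} (h : Match w i j r) {i' j' r' : ℕ} (c : ℕ)
    (hi : i' = i + c) (hj : j' = j + c) (hr : c + r' ≤ r) : Match w i' j' r' := by
  intro k hk
  have := h (c + k) (by omega)
  subst hi hj
  simpa only [Nat.add_assoc] using this

theorem Match.trans {w : List A} {i j l r : ℕ} (h : Match w i j r) (h' : Match w j l r) :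
    Match w i l r :=
  fun k hk => (h k hk).trans (h' k hk)

theorem length_factor (w : List A) {x e : ℕ} (he : e ≤ w.length) :
    (factor w x e).length = e - x := by
  simp [factor, he]

theorem getElem?_factor (w : List A) {x e i : ℕ} (hi : x + i < e) :
    (factor w x e)[i]? = w[x + i]? := by
  simp [factor, List.getElem?_drop, hi]

theorem match_factor_iff (w : List A) {x e i j r : ℕ} (hi : x + i + r ≤ e) (hj : x + j + r ≤ e) :
    Match (factor w x e) i j r ↔ Match w (x + i) (x + j) r := by
  refine forall₂_congr fun k hk => ?_
  rw [getElem?_factor w (by omega), getElem?_factor w (by omega), ← Nat.add_assoc,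
    ← Nat.add_assoc]

/-- Unborderedness in terms of the lengths of borders. -/
theorem unbordered_iff (f : List A) : Unbordered f ↔ ¬ Bordered f 0 f.length := by
  constructor
  · rintro h ⟨l, h0, hl, hm⟩
    have hb : f.take l = f.drop (f.length - l) := by
      apply List.ext_getElem?
      intro k
      by_cases hk : k < l
      · have := hm k hk
        simpa [List.getElem?_take, hk] using this
      · rw [List.getElem?_eq_none (by simp; omega), List.getElem?_eq_none (by simp; omega)]
    have := h (f.take l) ⟨by rw [Ne, List.take_eq_nil_iff]; rintro (h | h) <;> simp_all,
      List.take_prefix _ _, hb ▸ List.drop_suffix _ _⟩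
    have := congrArg List.length this
    simp at this
    omega
  · intro h b ⟨hne, hp, hs⟩
    by_contra hbf
    have hlt : b.length < f.length :=
      lt_of_le_of_ne hp.length_le fun hl => hbf (hp.eq_of_length hl)
    refine h ⟨b.length, List.length_pos_of_ne_nil hne, by omega, fun k hk => ?_⟩
    have h1 := List.prefix_iff_eq_take.1 hp
    have h2 := List.suffix_iff_eq_drop.1 hs
    have e1 : b[k]? = f[0 + k]? := by
      rw [h1, List.getElem?_take, if_pos hk, Nat.zero_add]
    have e2 : b[k]? = f[f.length - b.length + k]? := by
      conv_lhs => rw [h2]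
      rw [List.getElem?_drop]
    exact e1.symm.trans e2

theorem unbordered_factor_iff (w : List A) {x e : ℕ} (he : e ≤ w.length) :
    Unbordered (factor w x e) ↔ ¬ Bordered w x e := by
  rw [unbordered_iff, length_factor w he]
  refine not_congr (exists_congr fun l => and_congr_right fun h0 => ?_)
  rw [Nat.sub_zero]
  refine and_congr_right fun hl => ?_
  rw [match_factor_iff w (by omega) (by omega), Nat.add_zero,
    show x + (e - x - l) = e - l by omega]

theorem infix_iff_factor (w f : List A) (hf : f ≠ []) :
    f <:+: w ↔ ∃ x e, x < e ∧ e ≤ w.length ∧ f = factor w x e := by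
  constructor
  · rintro ⟨s, t, rfl⟩
    have := List.length_pos_of_ne_nil hf
    refine ⟨s.length, s.length + f.length, by omega, by simp, ?_⟩
    rw [factor, ← List.length_append, List.take_left' rfl, List.drop_left' rfl]
  · rintro ⟨x, e, -, -, rfl⟩
    exact (List.drop_suffix _ _).isInfix.trans (List.take_prefix _ _).isInfix

theorem maxUnbordered_eq (w : List A) :
    maxUnbordered w = sSup {m | ∃ x e, x < e ∧ e ≤ w.length ∧ ¬ Bordered w x e ∧ e - x = m} := by
  unfold maxUnbordered
  congr 1
  ext m
  constructor
  · rintro ⟨f, hf, hi, hu, rfl⟩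
    obtain ⟨x, e, hx, he, rfl⟩ := (infix_iff_factor w f hf).1 hi
    exact ⟨x, e, hx, he, (unbordered_factor_iff w he).1 hu, (length_factor w he).symm⟩
  · rintro ⟨x, e, hx, he, hu, rfl⟩
    have hl := length_factor w (x := x) he
    have hne : factor w x e ≠ [] := by
      intro h
      rw [h] at hl
      simp at hl
      omega
    exact ⟨factor w x e, hne, (infix_iff_factor w _ hne).2 ⟨x, e, hx, he, rfl⟩,
      (unbordered_factor_iff w he).2 hu, hl⟩

theorem bddAbove_unbordered (w : List A) :
    BddAbove {m | ∃ x e, x < e ∧ e ≤ w.length ∧ ¬ Bordered w x e ∧ e - x = m} :=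
  ⟨w.length, by rintro m ⟨x, e, hx, he, -, rfl⟩; omega⟩

theorem le_maxUnbordered {w : List A} {x e : ℕ} (hx : x < e) (he : e ≤ w.length)
    (hu : ¬ Bordered w x e) : e - x ≤ maxUnbordered w := by
  rw [maxUnbordered_eq]
  exact le_csSup (bddAbove_unbordered w) ⟨x, e, hx, he, hu, rfl⟩

theorem exists_maxUnbordered {w : List A} (hw : w ≠ []) :
    ∃ x e, x < e ∧ e ≤ w.length ∧ ¬ Bordered w x e ∧ e - x = maxUnbordered w := by
  have h0 := List.length_pos_of_ne_nil hw
  have := Nat.sSup_mem (s := {m | ∃ x e, x < e ∧ e ≤ w.length ∧ ¬ Bordered w x e ∧ e - x = m})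
    ⟨1, 0, 1, by omega, by omega, by rintro ⟨l, h1, h2, -⟩; omega, rfl⟩ (bddAbove_unbordered w)
  rw [← maxUnbordered_eq] at this
  exact this

theorem maxUnbordered_nil : maxUnbordered ([] : List A) = 0 := by
  rw [maxUnbordered_eq]
  have : {m | ∃ x e, x < e ∧ e ≤ ([] : List A).length ∧ ¬ Bordered ([] : List A) x e ∧
      e - x = m} = ∅ := by
    ext m
    simp only [Set.mem_ofPred_eq, Set.mem_empty_iff_false, iff_false]
    rintro ⟨x, e, hx, he, -⟩
    rw [List.length_nil] at he
    omega
  rw [this, csSup_empty]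
  rfl

theorem maxUnbordered_le_length (w : List A) : maxUnbordered w ≤ w.length := by
  rcases eq_or_ne w [] with rfl | hw
  · simp [maxUnbordered_nil]
  · obtain ⟨x, e, -, he, -, h⟩ := exists_maxUnbordered hw
    omega

theorem maxUnbordered_pos {w : List A} (hw : w ≠ []) : 0 < maxUnbordered w := by
  obtain ⟨x, e, hx, -, -, h⟩ := exists_maxUnbordered hw
  omega

/-- The shortest border is itself unbordered, and it does not overlap itself. -/
theorem Bordered.shortest {w : List A} {x e : ℕ} (h : Bordered w x e) :
    ∃ l, 0 < l ∧ 2 * l ≤ e - x ∧ Match w x (e - l) l ∧ ¬ Bordered w (e - l) e := by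
  classical
  obtain ⟨h0, hl, hm⟩ := Nat.find_spec h
  have hmin := fun l' (h' : l' < Nat.find h) => Nat.find_min h h'
  set l := Nat.find h
  refine ⟨l, h0, ?_, hm, ?_⟩
  · by_contra hlt
    refine hmin (2 * l - (e - x)) (by omega) ⟨by omega, by omega, ?_⟩
    exact (hm.sub (r' := 2 * l - (e - x)) 0 rfl rfl (by omega)).trans
      (hm.sub (e - x - l) (by omega) (by omega) (by omega))
  · rintro ⟨l', h0', hl', hm'⟩
    exact hmin l' (by omega) ⟨h0', by omega, (hm.sub 0 rfl rfl (by omega)).trans hm'⟩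

theorem hasPeriod_iff_match {w : List A} {p : ℕ} :
    w.HasPeriod p ↔ Match w 0 p (w.length - p) := by
  rw [List.hasPeriod_iff_getElem?]
  refine forall₂_congr fun k _ => ?_
  rw [Nat.zero_add, Nat.add_comm k p]

theorem shortestPeriod_spec (w : List A) :
    0 < shortestPeriod w ∧ Match w 0 (shortestPeriod w) (w.length - shortestPeriod w) := by
  have h : ({p | 0 < p ∧ w.HasPeriod p} : Set ℕ).Nonempty :=
    ⟨w.length + 1, by simp⟩
  have := Nat.sInf_mem h
  exact ⟨this.1, hasPeriod_iff_match.1 this.2⟩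

theorem shortestPeriod_le {w : List A} {p : ℕ} (hp : 0 < p) (h : Match w 0 p (w.length - p)) :
    shortestPeriod w ≤ p :=
  Nat.sInf_le ⟨hp, hasPeriod_iff_match.2 h⟩

theorem shortestPeriod_le_length {w : List A} (hw : w ≠ []) : shortestPeriod w ≤ w.length :=
  shortestPeriod_le (List.length_pos_of_ne_nil hw) (by intro k hk; omega)

theorem shortestPeriod_eq {w : List A} {p : ℕ} (hp : 0 < p) (h : Match w 0 p (w.length - p))
    (hmin : ∀ q, 0 < q → q < p → ¬ Match w 0 q (w.length - q)) : shortestPeriod w = p := by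
  refine le_antisymm (shortestPeriod_le hp h) ?_
  by_contra hlt
  exact hmin _ (shortestPeriod_spec w).1 (by omega) (shortestPeriod_spec w).2

/-- Every factor that is longer than a period is bordered. -/
theorem maxUnbordered_le_shortestPeriod {w : List A} (hw : w ≠ []) :
    maxUnbordered w ≤ shortestPeriod w := by
  obtain ⟨x, e, hx, he, hu, h⟩ := exists_maxUnbordered hw
  obtain ⟨hp, hm⟩ := shortestPeriod_spec w
  by_contra hlt
  refine hu ⟨e - x - shortestPeriod w, by omega, by omega, ?_⟩
  exact hm.sub x (by omega) (by omega) (by omega)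

/-- A border of length `l` of a factor amounts to the period `e - x - l`, which passes on to every
factor inside. -/
theorem shortestPeriod_factor_le {w : List A} {x e l a b : ℕ} (hxa : x ≤ a) (hbe : b ≤ e)
    (hb : b ≤ w.length) (hl : l < e - x) (h : Match w x (e - l) l) :
    shortestPeriod (factor w a b) ≤ e - x - l := by
  refine shortestPeriod_le (by omega) ?_
  rw [length_factor w hb]
  by_cases hc : e - x - l ≤ b - a
  · rw [match_factor_iff w (by omega) (by omega)]
    exact h.sub (a - x) (by omega) (by omega) (by omega)
  · intro k hk; omega

end Str

namespace Str

variable {A : Type u}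

/-! ### The first and the last symbols determine `L` and `per` -/

theorem getElem?_withSentinel_left (w : List A) {m i : ℕ} (hm : m ≤ w.length) (hi : i < m) :
    (withSentinel w m)[i]? = (w[i]?).map some := by
  rw [withSentinel, List.getElem?_append_left (by simp; omega), List.getElem?_map,
    List.getElem?_take, if_pos hi]

theorem getElem?_withSentinel_mid (w : List A) {m : ℕ} (hm : m ≤ w.length) :
    (withSentinel w m)[m]? = some none := by
  rw [withSentinel, List.getElem?_append_right (by simp)]
  simp [hm]

theorem getElem?_withSentinel_right (w : List A) {m i : ℕ} (hm : m ≤ w.length) :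
    (withSentinel w m)[m + 1 + i]? = (w[w.length - m + i]?).map some := by
  rw [withSentinel, List.getElem?_append_right (by simp; omega)]
  have : m + 1 + i - (List.map some (List.take m w)).length = i + 1 := by
    simp [hm]; omega
  rw [this, List.getElem?_cons_succ, List.getElem?_map, List.getElem?_drop]

theorem length_withSentinel (w : List A) {m : ℕ} (hm : m ≤ w.length) :
    (withSentinel w m).length = 2 * m + 1 := by
  simp [withSentinel]
  omega

/-- All proper borders of `w` have length at most `|w| - L(w)`, so the sentinel keeps them all; and
it admits no new ones, as it occurs only once. -/
theorem length_sub_shortestPeriod_eq (w : List A) (hw : w ≠ []) :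
    (w.length : ℤ) - shortestPeriod w =
      ((withSentinel w (w.length - maxUnbordered w)).length : ℤ) -
        shortestPeriod (withSentinel w (w.length - maxUnbordered w)) := by
  have h1 := maxUnbordered_le_shortestPeriod hw
  have h2 := maxUnbordered_pos hw
  have h3 := maxUnbordered_le_length w
  have h4 := shortestPeriod_le_length hw
  obtain ⟨-, h5⟩ := shortestPeriod_spec w
  set m := w.length - maxUnbordered w with hm
  have hmn : m ≤ w.length := by omega
  rw [shortestPeriod_eq (w := withSentinel w m)
    (p := 2 * m + 1 - (w.length - shortestPeriod w)) (by omega),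
    length_withSentinel w hmn]
  · omega
  · rw [length_withSentinel w hmn]
    intro k hk
    have := getElem?_withSentinel_right w (i := shortestPeriod w - maxUnbordered w + k) hmn
    rw [show m + 1 + (shortestPeriod w - maxUnbordered w + k) =
      2 * m + 1 - (w.length - shortestPeriod w) + k by omega,
      show w.length - m + (shortestPeriod w - maxUnbordered w + k) = shortestPeriod w + k by
        omega] at this
    rw [this, Nat.zero_add, getElem?_withSentinel_left w hmn (by omega)]
    have := h5 k (by omega)
    rw [Nat.zero_add] at this
    rw [this]
  · rw [length_withSentinel w hmn]
    intro q hq0 hq h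
    by_cases hqm : q ≤ m
    · have := h (m - q) (by omega)
      rw [Nat.zero_add, show q + (m - q) = m by omega, getElem?_withSentinel_mid w hmn,
        getElem?_withSentinel_left w hmn (by omega), Option.map_eq_some_iff] at this
      simp at this
    · have : shortestPeriod w ≤ w.length - (2 * m + 1 - q) := by
        refine shortestPeriod_le (by omega) fun k hk => ?_
        have := h k (by omega)
        have hr := getElem?_withSentinel_right w (i := q - (m + 1) + k) hmn
        rw [show m + 1 + (q - (m + 1) + k) = q + k by omega] at hr
        rw [hr, Nat.zero_add, getElem?_withSentinel_left w hmn (by omega)] at this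
        rw [Nat.zero_add, Option.map_injective (Option.some_injective A) this]
        congr 1
        omega
      omega

theorem getElem?_factor_append (S : List A) {a b c e i : ℕ} (hb : b ≤ S.length) (h : a ≤ b) :
    (i < b - a → (factor S a b ++ factor S c e)[i]? = S[a + i]?) ∧
    (b - a ≤ i → c + i < b - a + e → (factor S a b ++ factor S c e)[i]? = S[c + (i - (b - a))]?) := by
  constructor
  · intro hi
    rw [List.getElem?_append_left (by rw [length_factor S hb]; omega),
      getElem?_factor S (by omega)]
  · intro hi hi'
    rw [List.getElem?_append_right (by rw [length_factor S hb]; omega), length_factor S hb,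
      getElem?_factor S (by omega)]

/-- Cutting out the middle of `S`, up to the first and last `3 d` symbols, does not change
`|S| - L(S)`: with at most `d` symbols omitted at the ends, a factor of `S` and the corresponding
factor of the shortened string have the same borders of length up to `3 d` minus the number of
omitted symbols, and longer ones are excluded by the periods of the inner factors. -/
theorem length_sub_maxUnbordered_eq (S : List A) (d : ℕ) (hd : 6 * d < S.length)
    (Sbar S' Sbar' : List A)
    (hSbar : Sbar = factor S 0 (3 * d) ++ factor S (S.length - 3 * d) S.length)
    (hS' : S' = factor S d (S.length - d))
    (hSbar' : Sbar' = factor S d (3 * d) ++ factor S (S.length - 3 * d) (S.length - d))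
    (h1 : (Sbar.length : ℤ) - maxUnbordered Sbar ≤ d)
    (h2 : (S'.length : ℤ) - shortestPeriod S' ≤ d)
    (h3 : (Sbar'.length : ℤ) - shortestPeriod Sbar' ≤ d) :
    (S.length : ℤ) - maxUnbordered S = (Sbar.length : ℤ) - maxUnbordered Sbar := by
  have hS : S ≠ [] := by rintro rfl; simp at hd
  have hlbar : Sbar.length = 6 * d := by
    rw [hSbar, List.length_append, length_factor S (by omega), length_factor S le_rfl]; omega
  have hlbar' : Sbar'.length = 4 * d := by
    rw [hSbar', List.length_append, length_factor S (by omega), length_factor S (by omega)]; omega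
  have hl' : S'.length = S.length - 2 * d := by
    rw [hS', length_factor S (by omega)]; omega
  have hbl : ∀ i < 3 * d, Sbar[i]? = S[i]? := fun i hi => by
    rw [hSbar, (getElem?_factor_append S (by omega) (by omega)).1 (by omega), Nat.zero_add]
  have hbr : ∀ i, 3 * d ≤ i → i < 6 * d → Sbar[i]? = S[S.length - 6 * d + i]? := fun i hi hi' => by
    rw [hSbar, (getElem?_factor_append S (by omega) (by omega)).2 (by omega) (by omega)]
    congr 1; omega
  have hfac : Sbar' = factor Sbar d (5 * d) := by
    apply List.ext_getElem?
    intro i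
    by_cases hi : i < 4 * d
    · rw [getElem?_factor Sbar (by omega), hSbar']
      by_cases hi2 : i < 2 * d
      · rw [(getElem?_factor_append S (by omega) (by omega)).1 (by omega), hbl _ (by omega)]
      · rw [(getElem?_factor_append S (by omega) (by omega)).2 (by omega) (by omega),
          hbr _ (by omega) (by omega)]
        congr 1; omega
    · rw [List.getElem?_eq_none (by omega),
        List.getElem?_eq_none (by rw [length_factor Sbar (by omega)]; omega)]
  have hshort : ∀ x y l, x + l ≤ 3 * d → y + l ≤ 3 * d →
      (Match Sbar x (6 * d - y - l) l ↔ Match S x (S.length - y - l) l) := by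
    intro x y l hx hy
    refine forall₂_congr fun k hk => ?_
    rw [hbl _ (by omega), hbr _ (by omega) (by omega),
      show S.length - 6 * d + (6 * d - y - l + k) = S.length - y - l + k by omega]
  have hle := maxUnbordered_le_length Sbar
  -- `|S| - L(S) ≤ |Sbar| - L(Sbar)`
  have hA : S.length - (6 * d - maxUnbordered Sbar) ≤ maxUnbordered S := by
    obtain ⟨x, y, hxy, hu⟩ : ∃ x y, x + y = 6 * d - maxUnbordered Sbar ∧
        (0 < d → ¬ Bordered Sbar x (6 * d - y)) := by
      rcases Nat.eq_zero_or_pos d with rfl | hd0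
      · exact ⟨0, 0, by omega, by omega⟩
      · obtain ⟨x, e, hx, he, hu, h⟩ := exists_maxUnbordered (w := Sbar)
          (by rintro rfl; simp at hlbar; omega)
        refine ⟨x, 6 * d - e, by omega, fun _ => ?_⟩
        rwa [show 6 * d - (6 * d - e) = e by omega]
    have : ¬ Bordered S x (S.length - y) := by
      intro hb
      obtain ⟨l, h0, hl, hm, -⟩ := hb.shortest
      have := shortestPeriod_factor_le (a := d) (b := S.length - d) (by omega) (by omega)
        (by omega) (by omega) hm
      rw [← hS'] at this
      exact hu (by omega) ⟨l, h0, by omega, (hshort x y l (by omega) (by omega)).2 hm⟩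
    have := le_maxUnbordered (by omega) (by omega) this
    omega
  -- `|Sbar| - L(Sbar) ≤ |S| - L(S)`
  have hB : maxUnbordered S ≤ S.length - (6 * d - maxUnbordered Sbar) := by
    obtain ⟨x, e, hx, he, hu, h⟩ := exists_maxUnbordered hS
    by_contra hlt
    have : ¬ Bordered Sbar x (6 * d - (S.length - e)) := by
      intro hb
      obtain ⟨l, h0, hl, hm, -⟩ := hb.shortest
      have := shortestPeriod_factor_le (a := d) (b := 5 * d) (by omega) (by omega)
        (by omega) (by omega) hm
      rw [← hfac] at this
      have := (hshort x (S.length - e) l (by omega) (by omega)).1 hm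
      rw [show S.length - (S.length - e) = e by omega] at this
      exact hu ⟨l, h0, by omega, this⟩
    have := le_maxUnbordered (by omega) (by omega) this
    omega
  omega

end Str

/-! ### Averages over random strings -/

section Mean

variable {A : Type u} [Fintype A] {n : ℕ}

/-- The mean of `f` over a uniformly random string in `A ^ n`. -/
noncomputable def mean (f : (Fin n → A) → ℝ) : ℝ := (∑ S, f S) / (Fintype.card A : ℝ) ^ n

open Classical in
/-- The probability of `E` for a uniformly random string in `A ^ n`. -/
noncomputable def prob (E : (Fin n → A) → Prop) : ℝ := mean fun S => if E S then 1 else 0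

theorem mean_mono {f g : (Fin n → A) → ℝ} (h : ∀ S, f S ≤ g S) : mean f ≤ mean g :=
  div_le_div_of_nonneg_right (Finset.sum_le_sum fun S _ => h S) (by positivity)

theorem mean_add (f g : (Fin n → A) → ℝ) : mean (fun S => f S + g S) = mean f + mean g := by
  simp only [mean, Finset.sum_add_distrib, add_div]

theorem mean_sum {ι : Type*} (s : Finset ι) (f : ι → (Fin n → A) → ℝ) :
    mean (fun S => ∑ i ∈ s, f i S) = ∑ i ∈ s, mean (f i) := by
  simp only [mean, Finset.sum_div]
  rw [Finset.sum_comm]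

theorem mean_mul_left (c : ℝ) (f : (Fin n → A) → ℝ) : mean (fun S => c * f S) = c * mean f := by
  simp only [mean, ← Finset.mul_sum, mul_div_assoc]

theorem mean_const (hA : 2 ≤ Fintype.card A) (c : ℝ) : mean (fun _ : Fin n → A => c) = c := by
  classical
  have : (Fintype.card A : ℝ) ^ n ≠ 0 := pow_ne_zero _ (by positivity)
  simp only [mean, Finset.sum_const, Finset.card_univ, Fintype.card_fun, Fintype.card_fin,
    nsmul_eq_mul, Nat.cast_pow]
  field_simp

theorem prob_eq_card (E : (Fin n → A) → Prop) [DecidablePred E] :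
    prob E = ((Finset.univ.filter E).card : ℝ) / (Fintype.card A : ℝ) ^ n := by
  classical
  unfold prob mean
  congr 1
  rw [Finset.natCast_card_filter]
  exact Finset.sum_congr rfl fun S _ => by dsimp only; congr

theorem prob_nonneg (E : (Fin n → A) → Prop) : 0 ≤ prob E :=
  div_nonneg (Finset.sum_nonneg fun S _ => by split_ifs <;> norm_num) (by positivity)

theorem prob_mono {E F : (Fin n → A) → Prop} (h : ∀ S, E S → F S) : prob E ≤ prob F := by
  refine mean_mono fun S => ?_
  by_cases hE : E S
  · simp [hE, h S hE]
  · simp only [hE, if_false]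
    split_ifs <;> norm_num

theorem prob_le_one (hA : 2 ≤ Fintype.card A) (E : (Fin n → A) → Prop) : prob E ≤ 1 := by
  rw [← mean_const (A := A) (n := n) hA 1]
  exact mean_mono fun S => by split_ifs <;> norm_num

/-- The union bound. -/
theorem prob_le_sum {ι : Type*} (s : Finset ι) {E : (Fin n → A) → Prop}
    (F : ι → (Fin n → A) → Prop) (h : ∀ S, E S → ∃ i ∈ s, F i S) :
    prob E ≤ ∑ i ∈ s, prob (F i) := by
  classical
  unfold prob
  rw [← mean_sum]
  refine mean_mono fun S => ?_
  have h0 : ∀ i ∈ s, (0 : ℝ) ≤ if F i S then 1 else 0 := fun i _ => by split_ifs <;> norm_num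
  by_cases hE : E S
  · obtain ⟨i, hi, hF⟩ := h S hE
    refine le_trans ?_ (Finset.single_le_sum h0 hi)
    simp [hE, hF]
  · simp only [hE, if_false]
    exact Finset.sum_nonneg h0

theorem prob_or_le (E F : (Fin n → A) → Prop) : prob (fun S => E S ∨ F S) ≤ prob E + prob F := by
  unfold prob
  rw [← mean_add]
  refine mean_mono fun S => ?_
  by_cases hE : E S <;> by_cases hF : F S <;> simp [hE, hF]

end Mean

/-! ### Coincidences in random strings -/

section Coincidence

open Str

variable {A : Type u} {n : ℕ}

/-- Whether `D` holds does not depend on the symbol at the position `i`. -/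
def Free (D : (Fin n → A) → Prop) (i : ℕ) : Prop :=
  ∀ (h : i < n) (S : Fin n → A) (a : A), D (Function.update S ⟨i, h⟩ a) ↔ D S

theorem getElem?_ofFn_update (S : Fin n → A) {i j : ℕ} (h : i < n) (a : A) (hij : j ≠ i) :
    (List.ofFn (Function.update S ⟨i, h⟩ a))[j]? = (List.ofFn S)[j]? := by
  simp only [List.getElem?_ofFn]
  split_ifs with hj
  · rw [Function.update_of_ne (by simpa [Fin.ext_iff] using hij)]
  · rfl

theorem free_match {i j r c : ℕ} (hi : c < i ∨ i + r ≤ c) (hj : c < j ∨ j + r ≤ c) :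
    Free (fun S : Fin n → A => Match (List.ofFn S) i j r) c := by
  intro h S a
  refine forall₂_congr fun k hk => ?_
  rw [getElem?_ofFn_update S h a (by omega), getElem?_ofFn_update S h a (by omega)]

theorem Free.and {D E : (Fin n → A) → Prop} {i : ℕ} (hD : Free D i) (hE : Free E i) :
    Free (fun S => D S ∧ E S) i :=
  fun h S a => and_congr (hD h S a) (hE h S a)

variable [Fintype A]

theorem prob_and_symbol_eq_le {D : (Fin n → A) → Prop} {i j : ℕ} (hD : Free D i) (hi : i < n)
    (hj : j < n) (hij : i ≠ j) :
    prob (fun S => D S ∧ (List.ofFn S)[i]? = (List.ofFn S)[j]?) ≤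
      prob D * (1 / (Fintype.card A : ℝ)) := by
  classical
  rcases Nat.eq_zero_or_pos (Fintype.card A) with h0 | h0
  · have := Fintype.card_eq_zero_iff.1 h0
    have : IsEmpty (Fin n → A) := ⟨fun S => IsEmpty.false (S ⟨i, hi⟩)⟩
    simp [prob, mean]
  have key : (Finset.univ.filter fun S : Fin n → A =>
        D S ∧ (List.ofFn S)[i]? = (List.ofFn S)[j]?).card * Fintype.card A ≤
      (Finset.univ.filter D).card := by
    rw [← Finset.card_univ (α := A), ← Finset.card_product]
    refine Finset.card_le_card_of_injOn
      (fun p => Function.update p.1 ⟨i, hi⟩ p.2) ?_ ?_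
    · rintro ⟨S, a⟩ hS
      simp only [Finset.coe_product, Set.mem_prod, Finset.mem_coe, Finset.mem_filter,
        Finset.mem_univ, true_and] at hS ⊢
      exact (hD hi S a).2 hS.1.1
    · rintro ⟨S, a⟩ hS ⟨S', a'⟩ hS' heq
      simp only [Finset.coe_product, Set.mem_prod, Finset.mem_coe, Finset.mem_filter,
        Finset.mem_univ, true_and, and_true, List.getElem?_ofFn, hi, hj, dif_pos,
        Option.some.injEq] at hS hS' heq
      have hval : ∀ x : Fin n, Function.update S ⟨i, hi⟩ a x = Function.update S' ⟨i, hi⟩ a' x :=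
        fun x => congrFun heq x
      have hne : ∀ x : Fin n, x ≠ ⟨i, hi⟩ → S x = S' x := fun x hx => by
        simpa [Function.update_of_ne hx] using hval x
      have ha : a = a' := by simpa using hval ⟨i, hi⟩
      have hSS : S = S' := by
        funext x
        by_cases hx : x = ⟨i, hi⟩
        · rw [hx, hS.2, hS'.2]
          exact hne _ (by simpa [Fin.ext_iff] using hij.symm)
        · exact hne x hx
      rw [ha, hSS]
  have key' : ((Finset.univ.filter fun S : Fin n → A =>
      D S ∧ (List.ofFn S)[i]? = (List.ofFn S)[j]?).card : ℝ) * Fintype.card A ≤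
      (Finset.univ.filter D).card := by exact_mod_cast key
  have h0' : (0 : ℝ) < Fintype.card A := by exact_mod_cast h0
  rw [prob_eq_card, prob_eq_card, div_mul_eq_mul_div]
  refine div_le_div_of_nonneg_right ?_ (by positivity)
  rwa [mul_one_div, le_div_iff₀ h0']

/-- Two factors of length `r` at different positions, which may overlap, coincide with
probability `σ ^ (-r)`, even under a condition that does not concern the first of them. -/
theorem prob_and_match_le (r : ℕ) : ∀ {D : (Fin n → A) → Prop} {i j : ℕ},
    (∀ c, i ≤ c → c < i + r → Free D c) → i < j → j + r ≤ n →
    prob (fun S => D S ∧ Match (List.ofFn S) i j r) ≤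
      prob D * (1 / (Fintype.card A : ℝ)) ^ r := by
  induction r with
  | zero =>
    intro D i j _ _ _
    rw [pow_zero, mul_one]
    exact prob_mono fun S h => h.1
  | succ r ih =>
    intro D i j hD hij hj
    have h1 := ih (D := D) (i := i + 1) (j := j + 1) (fun c h h' => hD c (by omega) (by omega))
      (by omega) (by omega)
    have h2 := prob_and_symbol_eq_le (i := i) (j := j)
      ((hD i (by omega) (by omega)).and
        (free_match (A := A) (n := n) (i := i + 1) (j := j + 1) (r := r) (by omega) (by omega)))
      (by omega) (by omega) (by omega)
    calc _ ≤ _ := prob_mono fun S h => by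
            exact ⟨⟨h.1, h.2.sub 1 rfl rfl (by omega)⟩, h.2 0 (by omega)⟩
      _ ≤ _ := h2
      _ ≤ (prob D * (1 / (Fintype.card A : ℝ)) ^ r) * (1 / (Fintype.card A : ℝ)) :=
          mul_le_mul_of_nonneg_right h1 (by positivity)
      _ = _ := by rw [pow_succ, mul_assoc]

theorem prob_match_le (hA : 2 ≤ Fintype.card A) {i j r : ℕ} (hij : i < j) (hj : j + r ≤ n) :
    prob (fun S : Fin n → A => Match (List.ofFn S) i j r) ≤
      (1 / (Fintype.card A : ℝ)) ^ r := by
  have h := prob_and_match_le (A := A) (n := n) (D := fun _ => True) r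
    (fun c _ _ _ _ _ => Iff.rfl) hij hj
  simp only [true_and] at h
  refine h.trans ?_
  exact (mul_le_mul_of_nonneg_right (prob_le_one hA _) (by positivity)).trans_eq (one_mul _)

theorem sum_Ioc_pow_le {q : ℝ} (h0 : 0 ≤ q) (h : q ≤ 1 / 2) (a b : ℕ) :
    ∑ l ∈ Finset.Ioc a b, q ^ l ≤ q ^ a := by
  rcases le_total b a with hab | hab
  · rw [Finset.Ioc_eq_empty (by omega)]
    simpa using pow_nonneg h0 a
  have : ∑ l ∈ Finset.Ioc a b, q ^ l ≤ q ^ a - q ^ b := by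
    induction b, hab using Nat.le_induction with
    | base => simp
    | succ b hb ih =>
      rw [← Finset.insert_Ioc_right_eq_Ioc_add_one hb, Finset.sum_insert (by simp)]
      have : q ^ (b + 1) ≤ q ^ b * (1 / 2) := by
        rw [pow_succ]; exact mul_le_mul_of_nonneg_left h (pow_nonneg h0 b)
      linarith
  linarith [pow_nonneg h0 b]

theorem one_div_card_le (hA : 2 ≤ Fintype.card A) : 1 / (Fintype.card A : ℝ) ≤ 1 / 2 :=
  one_div_le_one_div_of_le (by norm_num) (by exact_mod_cast hA)

theorem prob_long_border_le (hA : 2 ≤ Fintype.card A) {x e : ℕ} (he : e ≤ n) (m : ℕ) :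
    prob (fun S : Fin n → A => ∃ l, m < l ∧ l < e - x ∧ Match (List.ofFn S) x (e - l) l) ≤
      (1 / (Fintype.card A : ℝ)) ^ m := by
  calc _ ≤ ∑ l ∈ Finset.Ioc m (e - x - 1),
        prob (fun S : Fin n → A => Match (List.ofFn S) x (e - l) l) :=
        prob_le_sum _ _ fun S ⟨l, h1, h2, h3⟩ => ⟨l, by rw [Finset.mem_Ioc]; omega, h3⟩
    _ ≤ ∑ l ∈ Finset.Ioc m (e - x - 1), (1 / (Fintype.card A : ℝ)) ^ l := by
        refine Finset.sum_le_sum fun l hl => ?_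
        rw [Finset.mem_Ioc] at hl
        exact prob_match_le hA (by omega) (by omega)
    _ ≤ _ := sum_Ioc_pow_le (by positivity) (one_div_card_le hA) _ _

end Coincidence

/-! ### The tail of `|S| - L(S)` for a random string -/

section Tail

open Str

variable {A : Type u} [Fintype A] {n : ℕ}

/-- Suppose that from every position `x ∈ [j, m)` a suffix of `S[0, z)` of length at most `m` and
different from `g` can be read. Then `S[j, m)` is parsed into such suffixes, and each composition
`l₁, l₂, …` of a number `≥ m - j` into their lengths has probability `σ ^ (-(l₁ + l₂ + ⋯))`. If
the numbers `t ^ (-l)` sum up to at most `1`, then there are at most `t ^ s` compositions of `s`,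
whence the bound. -/
theorem prob_parse_le {m z g : ℕ} {t : ℝ} (ht : 0 < t) (htA : t ≤ Fintype.card A)
    (hm : 3 * m ≤ z) (hz : z ≤ n)
    (hsum : ∑ l ∈ (Finset.Ioc 0 m).erase g, (1 / t) ^ l ≤ 1) (k : ℕ) :
    ∀ {D : (Fin n → A) → Prop} {j : ℕ}, m - j = k → (∀ c, j ≤ c → c < 2 * m → Free D c) →
    prob (fun S => D S ∧ ∀ x, j ≤ x → x < m → ∃ l, 0 < l ∧ l ≤ m ∧ l ≠ g ∧
      Match (List.ofFn S) x (z - l) l) ≤ prob D * (t / (Fintype.card A : ℝ)) ^ k := by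
  have hA0 : (0 : ℝ) < Fintype.card A := ht.trans_le htA
  have hq0 : 0 < t / (Fintype.card A : ℝ) := by positivity
  have hq1 : t / (Fintype.card A : ℝ) ≤ 1 := (div_le_one hA0).2 htA
  induction k using Nat.strong_induction_on with
  | _ k ih =>
  intro D j hk hD
  rcases Nat.eq_zero_or_pos k with rfl | hk0
  · rw [pow_zero, mul_one]
    exact prob_mono fun S h => h.1
  set R : ℕ → (Fin n → A) → Prop := fun j S => ∀ x, j ≤ x → x < m →
    ∃ l, 0 < l ∧ l ≤ m ∧ l ≠ g ∧ Match (List.ofFn S) x (z - l) l with hR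
  calc prob (fun S => D S ∧ R j S)
      ≤ ∑ l ∈ (Finset.Ioc 0 m).erase g,
          prob (fun S => (D S ∧ Match (List.ofFn S) j (z - l) l) ∧ R (j + l) S) := by
        refine prob_le_sum _ _ fun S h => ?_
        obtain ⟨l, h0, h1, h2, h3⟩ := h.2 j le_rfl (by omega)
        exact ⟨l, by simp [h0, h1, h2], ⟨h.1, h3⟩, fun x hx => h.2 x (by omega)⟩
    _ ≤ ∑ l ∈ (Finset.Ioc 0 m).erase g,
          prob D * (t / (Fintype.card A : ℝ)) ^ k * (1 / t) ^ l := by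
        refine Finset.sum_le_sum fun l hl => ?_
        simp only [Finset.mem_erase, Finset.mem_Ioc] at hl
        have h1 := ih (m - (j + l)) (by omega)
          (D := fun S => D S ∧ Match (List.ofFn S) j (z - l) l) (j := j + l) rfl
          (fun c h h' => (hD c (by omega) h').and (free_match (by omega) (by omega)))
        have h2 := prob_and_match_le (D := D) (i := j) (j := z - l) l
          (fun c h h' => hD c h (by omega)) (by omega) (by omega)
        -- parts that reach beyond `m` are overcounted
        have h3 : (t / (Fintype.card A : ℝ)) ^ (m - (j + l)) * (t / (Fintype.card A : ℝ)) ^ l ≤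
            (t / (Fintype.card A : ℝ)) ^ k := by
          rw [← pow_add]
          exact pow_le_pow_of_le_one hq0.le hq1 (by omega)
        have h4 : (t / (Fintype.card A : ℝ)) ^ l * (1 / t) ^ l =
            (1 / (Fintype.card A : ℝ)) ^ l := by
          rw [← mul_pow]; congr 1; field_simp
        calc _ ≤ _ := h1
          _ ≤ (prob D * (1 / (Fintype.card A : ℝ)) ^ l) *
              (t / (Fintype.card A : ℝ)) ^ (m - (j + l)) :=
            mul_le_mul_of_nonneg_right h2 (by positivity)
          _ = prob D * ((t / (Fintype.card A : ℝ)) ^ (m - (j + l)) *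
              (t / (Fintype.card A : ℝ)) ^ l) * (1 / t) ^ l := by rw [← h4]; ring
          _ ≤ _ := by
            have := prob_nonneg D
            gcongr
    _ ≤ prob D * (t / (Fintype.card A : ℝ)) ^ k * 1 := by
        rw [← Finset.mul_sum]
        exact mul_le_mul_of_nonneg_left hsum (mul_nonneg (prob_nonneg D) (by positivity))
    _ = _ := mul_one _

theorem sum_Ioc_pow_le_div {q : ℝ} (h0 : 0 ≤ q) (h1 : q < 1) (m : ℕ) :
    ∑ l ∈ Finset.Ioc 0 m, q ^ l ≤ q / (1 - q) := by
  have h : (∑ l ∈ Finset.Ioc 0 m, q ^ l) * (1 - q) = q - q ^ (m + 1) := by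
    induction m with
    | zero => simp
    | succ m ih =>
      rw [← Finset.insert_Ioc_right_eq_Ioc_add_one (Nat.zero_le m), Finset.sum_insert (by simp),
        add_mul, ih]
      ring
  rw [le_div_iff₀ (by linarith), h]
  linarith [pow_nonneg h0 (m + 1)]

/-- A parse of the prefix of length `m = 14 h` into suffixes that avoid the length `g`. The
exclusion is needed for the binary alphabet only, which has as many compositions as strings. The
factor `14` makes `(t / σ) ^ 14 ≤ 1 / σ` for `t = 19 / 10`, `σ = 2` and for `t = 2`, `σ ≥ 3`. -/
theorem prob_parse_le_pow (hA : 2 ≤ Fintype.card A) {h z g : ℕ} (hz : 3 * (14 * h) ≤ z)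
    (hzn : z ≤ n) (hg : Fintype.card A = 2 → g = 2 ∨ g = 3) :
    prob (fun S : Fin n → A => ∀ x < 14 * h, ∃ l, 0 < l ∧ l ≤ 14 * h ∧ l ≠ g ∧
      Match (List.ofFn S) x (z - l) l) ≤ (1 / (Fintype.card A : ℝ)) ^ h := by
  rcases Nat.eq_zero_or_pos h with rfl | hh
  · simpa using prob_le_one hA _
  have main : ∀ t : ℝ, 0 < t → t ≤ Fintype.card A →
      ∑ l ∈ (Finset.Ioc 0 (14 * h)).erase g, (1 / t) ^ l ≤ 1 →
      (t / (Fintype.card A : ℝ)) ^ 14 ≤ 1 / (Fintype.card A : ℝ) →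
      prob (fun S : Fin n → A => ∀ x < 14 * h, ∃ l, 0 < l ∧ l ≤ 14 * h ∧ l ≠ g ∧
        Match (List.ofFn S) x (z - l) l) ≤ (1 / (Fintype.card A : ℝ)) ^ h := by
    intro t ht htA hsum hpow
    have h1 := prob_parse_le (n := n) ht htA hz hzn hsum (14 * h) (D := fun _ => True) (j := 0)
      (by omega) (fun c _ _ _ _ _ => Iff.rfl)
    simp only [true_and, Nat.zero_le, forall_const] at h1
    refine h1.trans ?_
    rw [pow_mul]
    calc _ ≤ 1 * ((t / (Fintype.card A : ℝ)) ^ 14) ^ h :=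
          mul_le_mul_of_nonneg_right (prob_le_one hA _) (by positivity)
      _ = ((t / (Fintype.card A : ℝ)) ^ 14) ^ h := one_mul _
      _ ≤ _ := pow_le_pow_left₀ (by positivity) hpow h
  rcases hA.eq_or_lt with h2 | h3
  · have hc : (Fintype.card A : ℝ) = 2 := by rw [← h2]; norm_num
    refine main (19 / 10) (by norm_num) (by rw [hc]; norm_num) ?_ (by rw [hc]; norm_num)
    have hg' := hg h2.symm
    have hmem : g ∈ Finset.Ioc 0 (14 * h) := by rw [Finset.mem_Ioc]; omega
    have hs := Finset.add_sum_erase _ (fun l : ℕ => (1 / (19 / 10) : ℝ) ^ l) hmem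
    have hle := sum_Ioc_pow_le_div (q := 1 / (19 / 10)) (by norm_num) (by norm_num) (14 * h)
    norm_num at hs hle ⊢
    rcases hg' with rfl | rfl <;> norm_num at hs <;> linarith
  · have hc : (3 : ℝ) ≤ Fintype.card A := by exact_mod_cast h3
    refine main 2 (by norm_num) (by linarith) ?_ ?_
    · refine (Finset.sum_le_sum_of_subset_of_nonneg (Finset.erase_subset _ _)
        fun _ _ _ => by positivity).trans ?_
      exact (sum_Ioc_pow_le_div (by norm_num) (by norm_num) (14 * h)).trans_eq (by norm_num)
    · rw [div_pow, div_le_div_iff₀ (by positivity) (by positivity), one_mul]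
      calc (2 : ℝ) ^ 14 * Fintype.card A ≤ 3 ^ 13 * Fintype.card A := by gcongr; norm_num
        _ ≤ (Fintype.card A : ℝ) ^ 13 * Fintype.card A := by gcongr
        _ = _ := by ring

/-- Two of the last three symbols of a binary string are equal; so some suffix of length `2` or `3`
of `S` or of length `2` of `S` without the last symbol is bordered. -/
theorem exists_bordered_suffix (h2 : Fintype.card A = 2) (hn : 3 ≤ n) (S : Fin n → A) :
    ∃ y < 2, ∃ g, (g = 2 ∨ g = 3) ∧ Bordered (List.ofFn S) (n - y - g) (n - y) := by
  obtain ⟨a, b, hab, heq⟩ := Fintype.exists_ne_map_eq_of_card_lt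
    (fun a : Fin 3 => S ⟨n - 1 - a, by omega⟩) (by rw [Fintype.card_fin]; omega)
  have key : ∀ a b : ℕ, a < b → b < 3 →
      (List.ofFn S)[n - 1 - a]? = (List.ofFn S)[n - 1 - b]? →
      Bordered (List.ofFn S) (n - a - (b - a + 1)) (n - a) := by
    intro a b hab hb h
    refine ⟨1, one_pos, by omega, fun k hk => ?_⟩
    rw [show n - a - (b - a + 1) + k = n - 1 - b by omega,
      show n - a - 1 + k = n - 1 - a by omega, h]
  have hs : ∀ a : Fin 3, (List.ofFn S)[n - 1 - (a : ℕ)]? = some (S ⟨n - 1 - a, by omega⟩) := by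
    intro a
    rw [List.getElem?_ofFn, dif_pos]
  have h' : ∃ a b : ℕ, a < b ∧ b < 3 ∧
      (List.ofFn S)[n - 1 - a]? = (List.ofFn S)[n - 1 - b]? := by
    have hne : (a : ℕ) ≠ b := fun h => hab (Fin.ext h)
    rcases hne.lt_or_gt with h | h
    · exact ⟨a, b, h, b.2, by rw [hs, hs]; exact congrArg some heq⟩
    · exact ⟨b, a, h, a.2, by rw [hs, hs]; exact congrArg some heq.symm⟩
  obtain ⟨a, b, hab, hb, h⟩ := h'
  exact ⟨a, by omega, b - a + 1, by omega, key a b hab hb h⟩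

/-- If `|S| - L(S) > b`, then all factors that omit at most `b` symbols at the ends are bordered.
Either one of the shortest borders is long, or the shortest borders parse a prefix of `S` into
unbordered suffixes. -/
theorem prob_tail_le (hA : 2 ≤ Fintype.card A) (b : ℕ) :
    prob (fun S : Fin n → A => b < n - maxUnbordered (List.ofFn S)) ≤
      34 * (1 / (Fintype.card A : ℝ)) ^ (b / 42) := by
  have hA0 : (0 : ℝ) < Fintype.card A := by positivity
  set q := 1 / (Fintype.card A : ℝ) with hq
  have hq0 : 0 ≤ q := by positivity
  have hq2 : q ≤ 1 / 2 := one_div_card_le hA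
  set h := b / 42 with hh
  rcases Nat.eq_zero_or_pos h with h0 | h0
  · rw [h0, pow_zero]
    linarith [prob_le_one hA fun S : Fin n → A => b < n - maxUnbordered (List.ofFn S)]
  rcases le_or_gt n b with hnb | hnb
  · refine (prob_mono (F := fun _ => False) fun S hS => by omega).trans ?_
    have : prob (fun _ : Fin n → A => False) = 0 := by simp [prob, mean]
    rw [this]; positivity
  -- `3 m ≤ b < n`, so that the prefix and the suffixes of the parse are disjoint
  set m := 14 * h with hm
  -- `Q (x, y)`: the factor `S[x, n - y)` has a border longer than `m`
  set Q : ℕ × ℕ → (Fin n → A) → Prop := fun p S => ∃ l, m < l ∧ l < n - p.2 - p.1 ∧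
    Match (List.ofFn S) p.1 (n - p.2 - l) l with hQ
  -- `R (y, g)`: from all `x < m`, suffixes of `S[0, n - y)` of lengths `≠ g` can be read (no length
  -- is excluded by `g = 0`)
  set R : ℕ × ℕ → (Fin n → A) → Prop := fun p S => (Fintype.card A = 2 → p.2 = 2 ∨ p.2 = 3) ∧
    ∀ x < m, ∃ l, 0 < l ∧ l ≤ m ∧ l ≠ p.2 ∧ Match (List.ofFn S) x (n - p.1 - l) l with hR
  have hsplit : ∀ S : Fin n → A, b < n - maxUnbordered (List.ofFn S) →
      (∃ p ∈ Finset.range m ×ˢ Finset.range 2, Q p S) ∨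
      ∃ p ∈ Finset.range 2 ×ˢ ({0, 2, 3} : Finset ℕ), R p S := by
    intro S hS
    have hbord : ∀ x < m, ∀ y < 2, Bordered (List.ofFn S) x (n - y) := by
      intro x hx y hy
      by_contra hu
      have := le_maxUnbordered (w := List.ofFn S) (by omega) (by simp) hu
      omega
    by_cases hlong : ∃ p ∈ Finset.range m ×ˢ Finset.range 2, Q p S
    · exact Or.inl hlong
    right
    have hpar : ∀ y < 2, ∀ g, Bordered (List.ofFn S) (n - y - g) (n - y) ∨ g = 0 →
        ∀ x < m, ∃ l, 0 < l ∧ l ≤ m ∧ l ≠ g ∧ Match (List.ofFn S) x (n - y - l) l := by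
      intro y hy g hg x hx
      obtain ⟨l, hl0, hl, hM, hu⟩ := (hbord x hx y hy).shortest
      refine ⟨l, hl0, ?_, ?_, hM⟩
      · by_contra hlm
        exact hlong ⟨(x, y), by simp [hx, hy], l, by omega, by simp only; omega, hM⟩
      · rintro rfl
        rcases hg with hg | hg
        · exact hu hg
        · omega
    by_cases h2 : Fintype.card A = 2
    · obtain ⟨y, hy, g, hg, hB⟩ := exists_bordered_suffix h2 (by omega) S
      refine ⟨(y, g), ?_, fun _ => hg, hpar y hy g (Or.inl hB)⟩
      simp only [Finset.mem_product, Finset.mem_range, Finset.mem_insert, Finset.mem_singleton]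
      omega
    · exact ⟨(0, 0), by simp, fun h => absurd h h2, hpar 0 (by omega) 0 (Or.inr rfl)⟩
  have hQle : ∀ p ∈ Finset.range m ×ˢ Finset.range 2, prob (Q p) ≤ q ^ m := fun p _ =>
    prob_long_border_le hA (Nat.sub_le n p.2) m
  have hRle : ∀ p ∈ Finset.range 2 ×ˢ ({0, 2, 3} : Finset ℕ), prob (R p) ≤ q ^ h := by
    rintro ⟨y, g⟩ hp
    simp only [Finset.mem_product, Finset.mem_range] at hp
    by_cases hg : Fintype.card A = 2 → g = 2 ∨ g = 3
    · refine (prob_mono fun S hS => hS.2).trans ?_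
      exact prob_parse_le_pow hA (by omega) (by omega) hg
    · refine (prob_mono (F := fun _ => False) fun S hS => hg hS.1).trans ?_
      have : prob (fun _ : Fin n → A => False) = 0 := by simp [prob, mean]
      rw [this]; positivity
  -- the number of long border events, `2 m = 28 h`, is absorbed by the power
  have habs : (h : ℝ) * q ^ m ≤ q ^ h := by
    have h1 : (h : ℝ) * q ^ h ≤ 1 := by
      calc (h : ℝ) * q ^ h ≤ 2 ^ h * (1 / 2) ^ h := by
            gcongr
            exact_mod_cast (Nat.lt_two_pow_self (n := h)).le
        _ = 1 := by rw [← mul_pow]; norm_num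
    have h2 : q ^ m ≤ q ^ h * q ^ h := by
      rw [← pow_add]
      exact pow_le_pow_of_le_one hq0 (by linarith) (by omega)
    calc (h : ℝ) * q ^ m ≤ h * (q ^ h * q ^ h) := by gcongr
      _ = (h * q ^ h) * q ^ h := by ring
      _ ≤ 1 * q ^ h := by gcongr
      _ = _ := one_mul _
  calc _ ≤ _ := prob_mono hsplit
    _ ≤ _ := prob_or_le _ _
    _ ≤ ∑ p ∈ Finset.range m ×ˢ Finset.range 2, q ^ m +
        ∑ p ∈ Finset.range 2 ×ˢ ({0, 2, 3} : Finset ℕ), q ^ h :=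
      add_le_add ((prob_le_sum _ Q fun S hS => hS).trans (Finset.sum_le_sum hQle))
        ((prob_le_sum _ R fun S hS => hS).trans (Finset.sum_le_sum hRle))
    _ = 28 * (h * q ^ m) + 6 * q ^ h := by
      simp only [Finset.sum_const, Finset.card_product, Finset.card_range, nsmul_eq_mul, hm]
      norm_num
      ring
    _ ≤ 34 * q ^ h := by nlinarith [pow_nonneg hq0 h]

/-- The third moment of `|S| - L(S) + 1` is bounded, uniformly in the length and the alphabet. -/
theorem exists_mean_cube_le : ∃ C : ℝ, 0 ≤ C ∧ ∀ (A : Type u) [Fintype A] (n : ℕ),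
    2 ≤ Fintype.card A →
    mean (fun S : Fin n → A => ((n - maxUnbordered (List.ofFn S) + 1 : ℕ) : ℝ) ^ 3) ≤ C := by
  have hsum : Summable fun b : ℕ => 3 * ((b : ℝ) + 2) ^ 2 * (34 * (1 / 2 : ℝ) ^ (b / 42)) := by
    have h1 : Summable fun b : ℕ => 1632 * (((b : ℝ) ^ 2 + 1) * (99 / 100 : ℝ) ^ b) := by
      have hr : ‖(99 / 100 : ℝ)‖ < 1 := by rw [Real.norm_eq_abs, abs_of_nonneg] <;> norm_num
      have h2 := summable_pow_mul_geometric_of_norm_lt_one 2 hr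
      have h0 := summable_pow_mul_geometric_of_norm_lt_one 0 hr
      refine ((h2.add h0).congr fun b => ?_).mul_left 1632
      ring
    refine h1.of_nonneg_of_le (fun b => by positivity) fun b => ?_
    have hpow : (1 / 2 : ℝ) ^ (b / 42) ≤ 2 * (99 / 100 : ℝ) ^ b := by
      calc (1 / 2 : ℝ) ^ (b / 42) ≤ ((99 / 100 : ℝ) ^ 42) ^ (b / 42) := by
            gcongr; norm_num
        _ = (99 / 100 : ℝ) ^ (42 * (b / 42)) * 1 := by rw [pow_mul, mul_one]
        _ ≤ (99 / 100 : ℝ) ^ (42 * (b / 42)) * (2 * (99 / 100 : ℝ) ^ (b % 42)) := by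
            gcongr
            have : (99 / 100 : ℝ) ^ 41 ≤ (99 / 100 : ℝ) ^ (b % 42) :=
              pow_le_pow_of_le_one (by norm_num) (by norm_num)
                (by have := Nat.mod_lt b (show 0 < 42 by norm_num); omega)
            norm_num at this ⊢
            linarith
        _ = 2 * (99 / 100 : ℝ) ^ (42 * (b / 42) + b % 42) := by rw [pow_add]; ring
        _ = _ := by rw [Nat.div_add_mod]
    have hb : ((b : ℝ) + 2) ^ 2 ≤ 8 * ((b : ℝ) ^ 2 + 1) := by nlinarith [sq_nonneg ((b : ℝ) - 1)]
    calc 3 * ((b : ℝ) + 2) ^ 2 * (34 * (1 / 2 : ℝ) ^ (b / 42))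
        ≤ 3 * (8 * ((b : ℝ) ^ 2 + 1)) * (34 * (2 * (99 / 100 : ℝ) ^ b)) := by gcongr
      _ = _ := by ring
  refine ⟨1 + ∑' b : ℕ, 3 * ((b : ℝ) + 2) ^ 2 * (34 * (1 / 2 : ℝ) ^ (b / 42)),
    add_nonneg zero_le_one (tsum_nonneg fun b => by positivity), ?_⟩
  intro A _ n hA
  classical
  have hpt : ∀ N : ℕ, ∀ B ≤ N, ((B + 1 : ℕ) : ℝ) ^ 3 ≤
      1 + ∑ b ∈ Finset.range N, 3 * ((b : ℝ) + 2) ^ 2 * (if b < B then 1 else 0) := by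
    intro N
    induction N with
    | zero => intro B hB; simp [Nat.le_zero.1 hB]
    | succ N ih =>
      intro B hB
      rw [Finset.sum_range_succ]
      rcases hB.lt_or_eq with hlt | rfl
      · rw [if_neg (by omega)]
        have := ih B (by omega)
        linarith
      · have := ih N le_rfl
        have he : ∑ b ∈ Finset.range N, 3 * ((b : ℝ) + 2) ^ 2 * (if b < N + 1 then 1 else 0) =
            ∑ b ∈ Finset.range N, 3 * ((b : ℝ) + 2) ^ 2 * (if b < N then 1 else 0) := by
          refine Finset.sum_congr rfl fun b hb => ?_
          rw [Finset.mem_range] at hb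
          rw [if_pos (by omega), if_pos hb]
        rw [he, if_pos (by omega)]
        have hN : ((N + 1 + 1 : ℕ) : ℝ) ^ 3 ≤ ((N + 1 : ℕ) : ℝ) ^ 3 + 3 * ((N : ℝ) + 2) ^ 2 := by
          push_cast
          nlinarith [Nat.cast_nonneg (α := ℝ) N]
        linarith
  calc _ ≤ mean (fun S : Fin n → A => 1 + ∑ b ∈ Finset.range n, 3 * ((b : ℝ) + 2) ^ 2 *
          (if b < n - maxUnbordered (List.ofFn S) then 1 else 0)) :=
        mean_mono fun S => hpt n _ (Nat.sub_le _ _)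
    _ = 1 + ∑ b ∈ Finset.range n, 3 * ((b : ℝ) + 2) ^ 2 *
          prob (fun S : Fin n → A => b < n - maxUnbordered (List.ofFn S)) := by
        rw [mean_add, mean_const hA, mean_sum]
        congr 1
        refine Finset.sum_congr rfl fun b _ => ?_
        rw [mean_mul_left, prob]
        refine congrArg _ (congrArg mean (funext fun S => ?_))
        congr
    _ ≤ 1 + ∑ b ∈ Finset.range n, 3 * ((b : ℝ) + 2) ^ 2 * (34 * (1 / 2 : ℝ) ^ (b / 42)) := by
        gcongr with b
        refine (prob_tail_le hA b).trans ?_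
        gcongr
        exact_mod_cast hA
    _ ≤ _ := by
        gcongr
        exact hsum.sum_le_tsum _ fun b _ => by positivity

end Tail

/-! ### The number of comparisons of the search for an unbordered factor -/

namespace Str

variable {A : Type u}

open Classical in
/-- The length of the longest common prefix of the factors of length `l` at the positions `i` and
`j`. -/
noncomputable def matchLen (w : List A) (i j l : ℕ) : ℕ :=
  Nat.findGreatest (fun r => Match w i j r) l

theorem matchLen_le (w : List A) (i j l : ℕ) : matchLen w i j l ≤ l := by
  classical
  exact Nat.findGreatest_le l

theorem match_matchLen (w : List A) (i j l : ℕ) : Match w i j (matchLen w i j l) := by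
  classical
  exact Nat.findGreatest_spec (P := fun r => Match w i j r) (Nat.zero_le l)
    fun k hk => absurd hk (Nat.not_lt_zero k)

theorem Match.le_matchLen {w : List A} {i j r l : ℕ} (h : Match w i j r) (hr : r ≤ l) :
    r ≤ matchLen w i j l := by
  classical
  exact Nat.le_findGreatest hr h

theorem mean_matchLen_sub_le [Fintype A] (hA : 2 ≤ Fintype.card A) {n i j l : ℕ} (b : ℕ)
    (hij : i < j) (hj : j + l ≤ n) :
    mean (fun S : Fin n → A => ((matchLen (List.ofFn S) i j l - b : ℕ) : ℝ)) ≤ (1 / 2) ^ b := by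
  classical
  calc _ ≤ mean (fun S : Fin n → A =>
        ∑ r ∈ Finset.Ioc b l, if Match (List.ofFn S) i j r then (1 : ℝ) else 0) := by
        refine mean_mono fun S => ?_
        rw [Finset.sum_boole, ← Nat.card_Ioc]
        refine Nat.cast_le.2 (Finset.card_le_card fun r hr => ?_)
        rw [Finset.mem_Ioc] at hr
        rw [Finset.mem_filter, Finset.mem_Ioc]
        exact ⟨⟨hr.1, hr.2.trans (matchLen_le _ _ _ _)⟩,
          (match_matchLen _ i j l).sub 0 rfl rfl (by omega)⟩
    _ = ∑ r ∈ Finset.Ioc b l, prob (fun S : Fin n → A => Match (List.ofFn S) i j r) := by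
        rw [mean_sum]
        refine Finset.sum_congr rfl fun r _ => congrArg mean (funext fun S => ?_)
        congr
    _ ≤ ∑ r ∈ Finset.Ioc b l, (1 / 2 : ℝ) ^ r := by
        refine Finset.sum_le_sum fun r hr => ?_
        rw [Finset.mem_Ioc] at hr
        refine (prob_match_le hA hij (by omega)).trans ?_
        exact pow_le_pow_left₀ (by positivity) (one_div_card_le hA) r
    _ ≤ _ := sum_Ioc_pow_le (by norm_num) le_rfl _ _

/-- The lengths of borders that are tested for the factors of length `n - b` are `1, 2, …` up to
this bound: lengths above `3 d` are skipped if `b < E`. -/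
def borderLimit (n d E b : ℕ) : ℕ := if b < E then min (3 * d) (n - b - 1) else n - b - 1

/-- The number of symbol comparisons, with one more for every length, that are needed to test
border lengths from `l` on of the factor of length `n - b` that starts at the position `x`. -/
noncomputable def rowCost (w : List A) (d E b x l : ℕ) : ℕ :=
  ∑ l' ∈ Finset.Icc l (borderLimit w.length d E b),
    (matchLen w x (w.length + x - (b + l')) l' + 1)

/-- The number of comparisons for the factors of length `n - b` from the position `x` on. -/
noncomputable def levelCost (w : List A) (d E b x : ℕ) : ℕ :=
  ∑ x' ∈ Finset.Icc x b, rowCost w d E b x' 1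

/-- The number of comparisons for all factors of length `n - b ≥ L(w)`. -/
noncomputable def searchCost (w : List A) (d E : ℕ) : ℕ :=
  ∑ b ∈ Finset.range (w.length - maxUnbordered w + 1), levelCost w d E b 0

theorem rowCost_eq_add (w : List A) {d E b x l : ℕ} (hl : l ≤ borderLimit w.length d E b) :
    rowCost w d E b x l =
      matchLen w x (w.length + x - (b + l)) l + 1 + rowCost w d E b x (l + 1) := by
  rw [rowCost, ← Finset.insert_Icc_add_one_left_eq_Icc hl, Finset.sum_insert (by simp), rowCost]

theorem levelCost_eq_add (w : List A) {d E b x : ℕ} (hx : x ≤ b) :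
    levelCost w d E b x = rowCost w d E b x 1 + levelCost w d E b (x + 1) := by
  rw [levelCost, ← Finset.insert_Icc_add_one_left_eq_Icc hx, Finset.sum_insert (by simp), levelCost]

theorem searchCost_le_pow (w : List A) (d E : ℕ) : searchCost w d E ≤ w.length ^ 4 := by
  rcases eq_or_ne w [] with rfl | hw
  · simp [searchCost, levelCost, rowCost, borderLimit]
  have hpos := maxUnbordered_pos hw
  have hle := maxUnbordered_le_length w
  set n := w.length with hn
  have hlim : ∀ b, borderLimit n d E b ≤ n - 1 := fun b => by
    unfold borderLimit; split_ifs <;> omega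
  have hrow : ∀ b x, rowCost w d E b x 1 ≤ n ^ 2 := fun b x => by
    calc _ ≤ ∑ l' ∈ Finset.Icc 1 (borderLimit n d E b), n := by
          rw [rowCost, ← hn]
          refine Finset.sum_le_sum fun l hl => ?_
          rw [Finset.mem_Icc] at hl
          have := matchLen_le w x (n + x - (b + l)) l
          have := hlim b
          omega
      _ = borderLimit n d E b * n := by simp
      _ ≤ n * n := Nat.mul_le_mul_right _ ((hlim b).trans (by omega))
      _ = _ := by ring
  have hlevel : ∀ b < n, levelCost w d E b 0 ≤ n ^ 3 := fun b hb => by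
    calc _ ≤ ∑ x' ∈ Finset.Icc 0 b, n ^ 2 := Finset.sum_le_sum fun x _ => hrow b x
      _ = (b + 1) * n ^ 2 := by simp
      _ ≤ n * n ^ 2 := Nat.mul_le_mul_right _ (by omega)
      _ = _ := by ring
  calc _ ≤ ∑ b ∈ Finset.range (n - maxUnbordered w + 1), n ^ 3 :=
        Finset.sum_le_sum fun b hb => hlevel b (by rw [Finset.mem_range] at hb; omega)
    _ = (n - maxUnbordered w + 1) * n ^ 3 := by simp
    _ ≤ n * n ^ 3 := Nat.mul_le_mul_right _ (by omega)
    _ = _ := by ring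

/-- The part of `searchCost` that is due to common prefixes of length greater than `b` for factors
of length `n - b`. -/
noncomputable def excessCost (w : List A) (d : ℕ) : ℕ :=
  ∑ b ∈ Finset.range (d + 1), ∑ x ∈ Finset.Icc 0 b,
    ∑ l ∈ Finset.Icc 1 (min (3 * d) (w.length - b - 1)),
      (matchLen w x (w.length + x - (b + l)) l - b)

/-- Splitting off the excess decouples the number of factors that are tested from the cost of the
tests, which are correlated. -/
theorem searchCost_le (w : List A) {d : ℕ} (hd : w.length - maxUnbordered w ≤ d) :
    searchCost w d (d + 1) ≤
      3 * d * (w.length - maxUnbordered w + 1) ^ 3 + excessCost w d := by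
  set B := w.length - maxUnbordered w with hB
  have hrow : ∀ b ≤ B, ∀ x, rowCost w d (d + 1) b x 1 ≤ 3 * d * (B + 1) +
      ∑ l ∈ Finset.Icc 1 (min (3 * d) (w.length - b - 1)),
        (matchLen w x (w.length + x - (b + l)) l - b) := fun b hb x => by
    have hlim : borderLimit w.length d (d + 1) b = min (3 * d) (w.length - b - 1) :=
      if_pos (by omega)
    calc _ ≤ ∑ l ∈ Finset.Icc 1 (min (3 * d) (w.length - b - 1)),
          ((B + 1) + (matchLen w x (w.length + x - (b + l)) l - b)) := by
          rw [rowCost, hlim]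
          exact Finset.sum_le_sum fun l _ => by omega
      _ ≤ _ := by
          rw [Finset.sum_add_distrib]
          gcongr
          rw [Finset.sum_const, Nat.card_Icc, smul_eq_mul]
          exact Nat.mul_le_mul_right _ (by omega)
  calc _ ≤ ∑ b ∈ Finset.range (B + 1), ∑ x ∈ Finset.Icc 0 b, (3 * d * (B + 1) +
          ∑ l ∈ Finset.Icc 1 (min (3 * d) (w.length - b - 1)),
            (matchLen w x (w.length + x - (b + l)) l - b)) :=
        Finset.sum_le_sum fun b hb => Finset.sum_le_sum fun x _ =>
          hrow b (by rw [Finset.mem_range] at hb; omega) x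
    _ = ∑ b ∈ Finset.range (B + 1), (b + 1) * (3 * d * (B + 1)) +
        ∑ b ∈ Finset.range (B + 1), ∑ x ∈ Finset.Icc 0 b,
          ∑ l ∈ Finset.Icc 1 (min (3 * d) (w.length - b - 1)),
            (matchLen w x (w.length + x - (b + l)) l - b) := by
        simp [Finset.sum_add_distrib]
    _ ≤ ∑ b ∈ Finset.range (B + 1), (B + 1) * (3 * d * (B + 1)) + excessCost w d := by
        refine Nat.add_le_add (Finset.sum_le_sum fun b hb => ?_) ?_
        · rw [Finset.mem_range] at hb
          exact Nat.mul_le_mul_right _ (by omega)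
        · exact Finset.sum_le_sum_of_subset (Finset.range_subset_range.2 (by omega))
    _ = _ := by
        rw [Finset.sum_const, Finset.card_range, smul_eq_mul]
        ring

theorem sum_succ_mul_half_pow_le (N : ℕ) :
    ∑ b ∈ Finset.range N, ((b : ℝ) + 1) * (1 / 2) ^ b ≤ 4 := by
  have : ∑ b ∈ Finset.range N, ((b : ℝ) + 1) * (1 / 2) ^ b = 4 - (2 * N + 4) * (1 / 2) ^ N := by
    induction N with
    | zero => simp
    | succ N ih =>
      rw [Finset.sum_range_succ, ih, pow_succ]
      push_cast
      ring
  rw [this]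
  have : (0 : ℝ) ≤ (2 * N + 4) * (1 / 2) ^ N := by positivity
  linarith

theorem mean_excessCost_le [Fintype A] (hA : 2 ≤ Fintype.card A) {n : ℕ} (d : ℕ) :
    mean (fun S : Fin n → A => (excessCost (List.ofFn S) d : ℝ)) ≤ 12 * d := by
  have hexp : ∀ S : Fin n → A, (excessCost (List.ofFn S) d : ℝ) =
      ∑ b ∈ Finset.range (d + 1), ∑ x ∈ Finset.Icc 0 b,
        ∑ l ∈ Finset.Icc 1 (min (3 * d) (n - b - 1)),
          ((matchLen (List.ofFn S) x (n + x - (b + l)) l - b : ℕ) : ℝ) := fun S => by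
    simp only [excessCost, List.length_ofFn, Nat.cast_sum]
  simp only [hexp, mean_sum]
  calc _ ≤ ∑ b ∈ Finset.range (d + 1), ∑ x ∈ Finset.Icc 0 b,
          ∑ l ∈ Finset.Icc 1 (min (3 * d) (n - b - 1)), (1 / 2 : ℝ) ^ b := by
        refine Finset.sum_le_sum fun b _ => Finset.sum_le_sum fun x hx =>
          Finset.sum_le_sum fun l hl => ?_
        rw [Finset.mem_Icc] at hx hl
        exact mean_matchLen_sub_le hA b (by omega) (by omega)
    _ ≤ ∑ b ∈ Finset.range (d + 1), 3 * d * (((b : ℝ) + 1) * (1 / 2) ^ b) := by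
        refine Finset.sum_le_sum fun b _ => ?_
        simp only [Finset.sum_const, Nat.card_Icc, nsmul_eq_mul]
        have : ((min (3 * d) (n - b - 1) + 1 - 1 : ℕ) : ℝ) ≤ 3 * d := by
          exact_mod_cast (by omega : min (3 * d) (n - b - 1) + 1 - 1 ≤ 3 * d)
        calc _ ≤ ((b + 1 - 0 : ℕ) : ℝ) * (3 * d * (1 / 2 : ℝ) ^ b) := by gcongr
          _ = _ := by push_cast; ring
    _ ≤ 3 * d * 4 := by
        rw [← Finset.mul_sum]
        exact mul_le_mul_of_nonneg_left (sum_succ_mul_half_pow_le _) (by positivity)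
    _ = _ := by ring

/-- With an absent long period of the inner factor, border lengths above `3 d` need not be
tested. -/
theorem border_le_of_le_shortestPeriod {w : List A} {d b x l : ℕ} (hd : 2 * d < w.length)
    (hp : w.length ≤ shortestPeriod (factor w d (w.length - d)) + 3 * d) (hb : b ≤ d) (hx : x ≤ b)
    (hl : l < w.length - b) (h : Match w x (w.length + x - b - l) l) : l ≤ 3 * d := by
  have := shortestPeriod_factor_le (a := d) (b := w.length - d) (x := x)
    (e := w.length + x - b) (by omega) (by omega) (by omega) (by omega) h
  omega

theorem prob_shortestPeriod_factor_lt [Fintype A] (hA : 2 ≤ Fintype.card A) {n d : ℕ}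
    (hd : 2 * d < n) :
    prob (fun S : Fin n → A => shortestPeriod (factor (List.ofFn S) d (n - d)) + 3 * d < n) ≤
      (1 / (Fintype.card A : ℝ)) ^ d := by
  refine (prob_mono fun S hS => ?_).trans
    (prob_long_border_le (n := n) hA (x := d) (e := n - d) (by omega) d)
  obtain ⟨h0, h1⟩ := shortestPeriod_spec (factor (List.ofFn S) d (n - d))
  rw [length_factor _ (by simp), match_factor_iff _ (by omega) (by omega)] at h1
  exact ⟨n - d - d - shortestPeriod (factor (List.ofFn S) d (n - d)), by omega, by omega,
    h1.sub 0 (by omega) (by omega) (by omega)⟩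

end Str

/-! ### Runs of loops -/

namespace RAM

open Str

variable {A : Type u} {W : ℕ} {S : List A} {O : List A → ℕ}

/-- A loop halts in at most `Φ` steps, up to the last test, if its body preserves an invariant and
lowers the potential `Φ` by its running time. -/
theorem Exec.loop_of_potential {b : Test} {P : Prog} (I : Store → Prop) (Φ : Store → ℕ)
    (h : ∀ s, I s → b.Holds S s → ∃ s' t, Exec W S O P s s' t [] ∧ I s' ∧
      t + b.cost + 1 + Φ s' ≤ Φ s) :
    ∀ s, I s → ∃ s' t, Exec W S O (.loop b P) s s' t [] ∧ I s' ∧ ¬ b.Holds S s' ∧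
      t ≤ Φ s + b.cost + 1 := by
  suffices H : ∀ N s, Φ s ≤ N → I s → ∃ s' t, Exec W S O (.loop b P) s s' t [] ∧ I s' ∧
      ¬ b.Holds S s' ∧ t ≤ Φ s + b.cost + 1 from fun s hs => H (Φ s) s le_rfl hs
  intro N
  induction N using Nat.strong_induction_on with
  | _ N ih =>
  intro s hN hs
  by_cases hb : b.Holds S s
  · obtain ⟨s₁, t₁, hP, hI, ht⟩ := h s hs hb
    obtain ⟨s₂, t₂, hL, hI₂, hb₂, ht₂⟩ := ih (Φ s₁) (by omega) s₁ le_rfl hI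
    exact ⟨s₂, _, Exec.loopTrue hb hP hL, hI₂, hb₂, by omega⟩
  · exact ⟨s, _, Exec.loopFalse hb, hs, hb, by omega⟩

theorem symEq_holds_iff {e f : Exp} {s : Store} (h : e.eval s < S.length) :
    (Test.symEq e f).Holds S s ↔ S[e.eval s]? = S[f.eval s]? := by
  have := List.getElem?_eq_getElem h
  constructor
  · rintro ⟨a, h1, h2⟩
    rw [h1, h2]
  · intro h'
    exact ⟨S[e.eval s], this, by rw [← h', this]⟩

/-- `Exec.assign` with the final store and the number of steps given up to equality. -/
theorem Exec.assign_of_eq (x : ℕ) (e : Exp) (s : Store) {s' : Store} {t : ℕ} (h : e.eval s < W)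
    (hs : s' = { s with vars := Function.update s.vars x (e.eval s) }) (ht : t = e.cost + 1) :
    Exec W S O (.assign x e) s s' t [] := by
  subst hs ht
  exact Exec.assign x e s h

/-! ### The shortest period from the longest unbordered factor -/

/-- Compares the prefix and the suffix of length `v₃` symbol by symbol (`v₄` symbols agree so far);
at a mismatch, `v₃` is lowered. -/
def periodStep : Prog :=
  .ite (.symEq (.var 4) (.add (.sub (.var 0) (.var 3)) (.var 4)))
    (.assign 4 (.add (.var 4) (.lit 1)))
    (.seq (.assign 3 (.sub (.var 3) (.lit 1))) (.assign 4 (.lit 0)))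

/-- Computes the shortest period: as it is at least `L(S)`, the longest border is searched for among
the lengths `n - L(S), …, 1, 0` (with `0` for the empty border). -/
def periodProg : Prog :=
  .seq (.query 2 (.lit 0) (.var 0)) <|
  .seq (.assign 3 (.sub (.var 0) (.var 2))) <|
  .seq (.loop (.lt (.var 4) (.var 3)) periodStep)
    (.assign 0 (.sub (.var 0) (.var 3)))

theorem factor_zero_length (w : List A) : factor w 0 w.length = w := by
  simp [factor]

/-- The loop of `periodProg`, for borders of length at most `m`. -/
theorem exec_periodLoop {n m : ℕ} (hn : S.length = n) (hm : m < n) (hW : n + 1 < W) (s : Store)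
    (h0 : s.vars 0 = n) (h3 : s.vars 3 = m) (h4 : s.vars 4 = 0) :
    ∃ s' t, Exec W S O (.loop (.lt (.var 4) (.var 3)) periodStep) s s' t [] ∧
      s'.vars 0 = n ∧ s'.vars 3 ≤ m ∧ Match S 0 (n - s'.vars 3) (s'.vars 3) ∧
      (∀ l, s'.vars 3 < l → l ≤ m → ¬ Match S 0 (n - l) l) ∧ t ≤ 22 * (m + 1) ^ 2 := by
  obtain ⟨s', t, hE, ⟨i0, i3, i4, iM, iN⟩, hb, ht⟩ :=
    Exec.loop_of_potential (W := W) (S := S) (O := O) (b := .lt (.var 4) (.var 3))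
      (P := periodStep)
      (fun s => s.vars 0 = n ∧ s.vars 3 ≤ m ∧ s.vars 4 ≤ s.vars 3 ∧
        Match S 0 (n - s.vars 3) (s.vars 4) ∧
        ∀ l, s.vars 3 < l → l ≤ m → ¬ Match S 0 (n - l) l)
      (fun s => 20 * ((m + 1) * s.vars 3 + (s.vars 3 - s.vars 4)))
      (by
        rintro s ⟨i0, i3, i4, iM, iN⟩ hb
        simp only [Test.Holds, Exp.eval] at hb
        have hsym := symEq_holds_iff (S := S) (s := s) (e := .var 4)
          (f := .add (.sub (.var 0) (.var 3)) (.var 4)) (by simp only [Exp.eval]; omega)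
        by_cases hc : (Test.symEq (.var 4) (.add (.sub (.var 0) (.var 3)) (.var 4))).Holds S s
        · refine ⟨_, _, Exec.iteTrue hc (Exec.assign 4 _ s (by simp only [Exp.eval]; omega)),
            ?_, ?_⟩
          · rw [hsym] at hc
            simp only [Exp.eval, i0] at hc
            simp [Exp.eval, i0, i3]
            refine ⟨by omega, fun k hk => ?_, iN⟩
            rcases (by omega : k < s.vars 4 ∨ k = s.vars 4) with hk | rfl
            · exact iM k hk
            · rwa [Nat.zero_add]
          · simp [Exp.eval, Exp.cost, Test.cost]
            omega
        · refine ⟨_, _, Exec.iteFalse hc (Exec.seq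
            (Exec.assign 3 _ s (by simp only [Exp.eval]; omega))
            (Exec.assign 4 _ _ (by simp only [Exp.eval]; omega))), ?_, ?_⟩
          · rw [hsym] at hc
            simp only [Exp.eval, i0] at hc
            simp [Exp.eval, i0]
            refine ⟨by omega, fun k hk => by omega, fun l hl hlm hM => ?_⟩
            rcases (by omega : s.vars 3 < l ∨ l = s.vars 3) with hl | rfl
            · exact iN l hl hlm hM
            · have := hM (s.vars 4) hb
              rw [Nat.zero_add] at this
              exact hc this
          · simp [Exp.eval, Exp.cost, Test.cost]
            obtain ⟨v, hv⟩ : ∃ v, s.vars 3 = v + 1 := ⟨s.vars 3 - 1, by omega⟩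
            rw [hv] at i3 i4 ⊢
            rw [Nat.add_sub_cancel, Nat.mul_succ]
            omega)
      s ⟨h0, by omega, by omega, fun k hk => by omega, fun l hl hlm => by omega⟩
  simp only [Test.Holds, Exp.eval] at hb
  refine ⟨s', t, hE, i0, i3, ?_, iN, ?_⟩
  · rwa [show s'.vars 4 = s'.vars 3 by omega] at iM
  · simp only [h3, h4, Test.cost, Exp.cost, Nat.sub_zero] at ht
    nlinarith

theorem runs_periodProg {n σ : ℕ} (hn : S.length = n) (h1 : 1 ≤ n) (hW : n + 1 < W) :
    ∃ t, RunsWithOneQuery W σ S maxUnbordered periodProg 0 n (shortestPeriod S) t ∧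
      t ≤ 40 * (n - maxUnbordered S + 1) ^ 2 := by
  subst hn
  have hS : S ≠ [] := List.ne_nil_of_length_pos h1
  have hL0 := maxUnbordered_pos hS
  have hL1 := maxUnbordered_le_length S
  have hfac := factor_zero_length S
  set m := S.length - maxUnbordered S with hm
  have hq : Exec W S maxUnbordered (.query 2 (.lit 0) (.var 0)) (initStore S.length σ) _ _ _ :=
    Exec.query 2 (.lit 0) (.var 0) _ (by simp [Exp.eval, initStore]; omega)
      (by simp [Exp.eval, initStore]) (by simp [Exp.eval, initStore, hfac]; omega)
  have hv : ∀ x, (initStore S.length σ).vars x = if x = 0 then S.length else if x = 1 then σ else 0 :=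
    fun x => rfl
  simp only [Exp.eval, hv, if_pos, hfac] at hq
  obtain ⟨s', t, hE, i0, i3, iM, iN, ht⟩ := exec_periodLoop (W := W) (O := maxUnbordered) (m := m)
    rfl (by omega) hW
    { (initStore S.length σ) with
      vars := Function.update (Function.update (initStore S.length σ).vars 2 (maxUnbordered S)) 3 m }
    (by simp [hv]) (by simp) (by simp [hv])
  refine ⟨_, ⟨_, Exec.seq hq (Exec.seq (Exec.assign_of_eq 3 _ _ ?_ ?_ rfl)
    (Exec.seq hE (Exec.assign 0 _ _ ?_))), ?_⟩, ?_⟩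
  · simp only [Exp.eval, Function.update_self, ne_eq, OfNat.zero_ne_ofNat,
      not_false_eq_true, Function.update_of_ne, hv, if_pos]
    omega
  · simp [Exp.eval, hv, hm]
  · simp only [Exp.eval]; omega
  · simp only [Exp.eval, Function.update_self, i0]
    refine (shortestPeriod_eq (by omega) ?_ fun q hq0 hq hM => ?_).symm
    · exact iM.sub 0 rfl rfl (by omega)
    · have := maxUnbordered_le_shortestPeriod hS
      have := shortestPeriod_le hq0 hM
      exact iN (S.length - q) (by omega) (by omega) (hM.sub 0 rfl (by omega) (by omega))
  · simp only [Exp.cost]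
    nlinarith [Nat.zero_le m]

end RAM

namespace RAM

open Str

variable {A : Type u} {W : ℕ} {S : List A} {O : List A → ℕ}

/-! ### The longest unbordered factor from the shortest period of an inner factor -/

/-- Started with `v₂ = 1` and `v₃ = 0`, the loop multiplies `v₂` by `σ` until it is at least `n`, and
so obtains `v₃ = 210 ⌈log_σ n⌉`. -/
def logLoop : Prog :=
  .loop (.lt (.var 2) (.var 0))
    (.seq (.assign 2 (.mul (.var 2) (.var 1))) (.assign 3 (.add (.var 3) (.lit 210))))

/-- Is the length `v₈` still to be tested as a border length of a factor of length `n - v₆`?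
Lengths above `3 v₃` are skipped as long as `v₆ < v₅`. -/
def searchTest : Test :=
  .and (.lt (.var 8) (.sub (.var 0) (.var 6)))
    (.not (.and (.lt (.mul (.lit 3) (.var 3)) (.var 8)) (.lt (.var 6) (.var 5))))

/-- One step of the comparison of the prefix and the suffix of length `v₈` of the factor of length
`n - v₆` that starts at the position `v₇`; `v₉` symbols agree so far. A mismatch leads to the next
length, and a border to the next factor. -/
def searchStep : Prog :=
  .ite (.lt (.var 9) (.var 8))
    (.ite (.symEq (.add (.var 7) (.var 9))
        (.add (.sub (.add (.var 0) (.var 7)) (.add (.var 6) (.var 8))) (.var 9)))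
      (.assign 9 (.add (.var 9) (.lit 1)))
      (.seq (.assign 8 (.add (.var 8) (.lit 1))) (.assign 9 (.lit 0))))
    (.seq
      (.ite (.lt (.var 7) (.var 6)) (.assign 7 (.add (.var 7) (.lit 1)))
        (.seq (.assign 6 (.add (.var 6) (.lit 1))) (.assign 7 (.lit 0))))
      (.seq (.assign 8 (.lit 1)) (.assign 9 (.lit 0))))

/-- Computes `L(S)`: asks for the shortest period of the factor that omits the first and last `v₃`
symbols, and searches for an unbordered factor in the order of descending lengths. -/
def unborderedProg : Prog :=
  .seq (.assign 2 (.lit 1)) <|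
  .seq logLoop <|
  .seq (.ite (.lt (.mul (.lit 2) (.var 3)) (.var 0)) .skip (.assign 3 (.lit 0))) <|
  .seq (.query 4 (.var 3) (.sub (.var 0) (.var 3))) <|
  .seq (.ite (.lt (.add (.var 4) (.mul (.lit 3) (.var 3))) (.var 0)) .skip
    (.assign 5 (.add (.var 3) (.lit 1)))) <|
  .seq (.assign 8 (.lit 1)) <|
  .seq (.loop searchTest searchStep)
    (.assign 0 (.sub (.var 0) (.var 6)))

/-- The number of symbols that are omitted at both ends of the factor that the oracle is asked
about. It is a multiple of `⌈log_σ n⌉` such that `|S| - L(S)` exceeds it with probability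
`O(n ^ (-4))`; for the bounded lengths that leave no factor between such margins, the oracle is
asked about `S` itself. -/
def margin (n σ : ℕ) : ℕ := if 2 * (210 * Nat.clog σ n) < n then 210 * Nat.clog σ n else 0

theorem two_mul_margin_lt {n : ℕ} (σ : ℕ) (hn : 1 ≤ n) : 2 * margin n σ < n := by
  unfold margin; split_ifs <;> omega

theorem exec_logLoop {n σ : ℕ} (hσ : 2 ≤ σ) (hW1 : n * σ < W)
    (hW2 : 210 * n < W) (s : Store) (h0 : s.vars 0 = n) (h1 : s.vars 1 = σ) (h2 : s.vars 2 = 1)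
    (h3 : s.vars 3 = 0) :
    ∃ s' t, Exec W S O logLoop s s' t [] ∧ s'.vars 3 = 210 * Nat.clog σ n ∧
      (∀ x, x ≠ 2 → x ≠ 3 → s'.vars x = s.vars x) ∧ t ≤ 12 * Nat.clog σ n + 4 := by
  obtain ⟨s', t, hE, ⟨q, i2, i3, iq, ix⟩, hb, ht⟩ :=
    Exec.loop_of_potential (W := W) (S := S) (O := O) (b := .lt (.var 2) (.var 0))
      (P := .seq (.assign 2 (.mul (.var 2) (.var 1))) (.assign 3 (.add (.var 3) (.lit 210))))
      (fun r => ∃ q, r.vars 2 = σ ^ q ∧ r.vars 3 = 210 * q ∧ q ≤ Nat.clog σ n ∧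
        ∀ x, x ≠ 2 → x ≠ 3 → r.vars x = s.vars x)
      (fun r => 12 * Nat.clog σ n - r.vars 3 * 12 / 210)
      (by
        rintro r ⟨q, i2, i3, iq, ix⟩ hb
        have j0 := ix 0 (by omega) (by omega)
        have j1 := ix 1 (by omega) (by omega)
        simp only [Test.Holds, Exp.eval, i2, j0, h0] at hb
        have hq := (Nat.lt_clog_iff_pow_lt (by omega : 1 < σ)).2 hb
        have hqn : q < n := (Nat.lt_pow_self (by omega : 1 < σ)).trans hb
        refine ⟨_, _, Exec.seq (Exec.assign 2 _ r ?_) (Exec.assign 3 _ _ ?_),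
          ⟨q + 1, ?_, ?_, hq, ?_⟩, ?_⟩
        · simp only [Exp.eval, i2, j1, h1]
          exact (Nat.mul_le_mul_right σ hb.le).trans_lt hW1
        · simp [Exp.eval, i3]; omega
        · simp [Exp.eval, i2, j1, h1, pow_succ]
        · simp [Exp.eval, i3]; omega
        · intro x hx2 hx3
          simp [hx2, hx3, ix x hx2 hx3]
        · simp [Exp.cost, Test.cost, Exp.eval, i3]
          omega)
      s ⟨0, by simpa using h2, by simpa using h3, Nat.zero_le _, fun _ _ _ => rfl⟩
  simp only [Test.Holds, Exp.eval, i2, ix 0 (by omega) (by omega), h0, not_lt] at hb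
  refine ⟨s', t, hE, ?_, ix, ?_⟩
  · rw [i3, le_antisymm iq (Nat.clog_le_of_le_pow hb)]
  · simp only [h3, Test.cost, Exp.cost] at ht
    omega

/-- The potential of `exec_searchLoop`: the number of comparisons that may still be made. -/
noncomputable def searchPotential (w : List A) (d E b x l k : ℕ) : ℕ :=
  (rowCost w d E b x l - k) + levelCost w d E b (x + 1) +
    ∑ b' ∈ Finset.Ioc b (w.length - maxUnbordered w), levelCost w d E b' 0

theorem searchPotential_zero (w : List A) (d E : ℕ) :
    searchPotential w d E 0 0 1 0 = searchCost w d E := by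
  rw [searchPotential, Nat.sub_zero, ← levelCost_eq_add w le_rfl, searchCost,
    Finset.range_eq_Ico, Finset.sum_eq_sum_Ico_succ_bot (by omega)]
  rfl

/-- A factor that omits `b` symbols of `w` is bordered if no border length up to `borderLimit`
occurs; the lengths above are excluded by the period of the inner factor. -/
theorem not_bordered_of_limit {w : List A} {d E b x l : ℕ} (hd : 2 * d < w.length)
    (hE : 0 < E → E = d + 1 ∧ w.length ≤ shortestPeriod (factor w d (w.length - d)) + 3 * d)
    (hx : x ≤ b) (hb : b < w.length) (hl : borderLimit w.length d E b < l)
    (h : ∀ l' < l, 0 < l' → ¬ Match w x (w.length + x - (b + l')) l') :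
    ¬ Bordered w x (w.length + x - b) := by
  rintro ⟨l', h0, hl', hM⟩
  refine h l' ?_ h0 (hM.sub 0 rfl (by omega) (by omega))
  refine lt_of_le_of_lt ?_ hl
  unfold borderLimit
  split_ifs with hbE
  · have := border_le_of_le_shortestPeriod hd (hE (by omega)).2 (by omega) hx (by omega) hM
    omega
  · omega

/-- The number of omitted symbols is at most `|w| - L(w)` as long as only bordered factors have been
met. -/
theorem le_length_sub_maxUnbordered {w : List A} (hw : w ≠ []) {b : ℕ}
    (h : ∀ b' < b, ∀ x ≤ b', Bordered w x (w.length + x - b')) :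
    b ≤ w.length - maxUnbordered w := by
  obtain ⟨x, e, hx, he, hu, heq⟩ := exists_maxUnbordered hw
  by_contra hlt
  have := h (w.length - maxUnbordered w) (by omega) x (by omega)
  rw [show w.length + x - (w.length - maxUnbordered w) = e by omega] at this
  exact hu this

/-- The invariant of `exec_searchLoop`: all factors before the current one are bordered, the current
one has no border of a length below `v₈`, and `v₉` symbols agree. -/
def SearchInv (w : List A) (d E : ℕ) (s : Store) : Prop :=
  s.vars 0 = w.length ∧ s.vars 3 = d ∧ s.vars 5 = E ∧ s.vars 7 ≤ s.vars 6 ∧ 1 ≤ s.vars 8 ∧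
  s.vars 9 ≤ s.vars 8 ∧
  (∀ b' < s.vars 6, ∀ x ≤ b', Bordered w x (w.length + x - b')) ∧
  (∀ x < s.vars 7, Bordered w x (w.length + x - s.vars 6)) ∧
  (∀ l < s.vars 8, 0 < l → ¬ Match w (s.vars 7) (w.length + s.vars 7 - (s.vars 6 + l)) l) ∧
  Match w (s.vars 7) (w.length + s.vars 7 - (s.vars 6 + s.vars 8)) (s.vars 9)

theorem searchTest_holds_iff {w : List A} {d E : ℕ} {s : Store} (h : SearchInv w d E s) :
    searchTest.Holds w s ↔ s.vars 8 ≤ borderLimit w.length d E (s.vars 6) := by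
  obtain ⟨h0, h3, h5, -, h8, -⟩ := h
  simp only [searchTest, Test.Holds, Exp.eval, h0, h3, h5, borderLimit]
  split_ifs <;> omega

theorem exec_searchStep (hS : S ≠ []) {d E : ℕ} (hW : S.length + 1 < W) (s : Store)
    (hI : SearchInv S d E s) (hb : s.vars 8 ≤ borderLimit S.length d E (s.vars 6)) :
    ∃ s' t, Exec W S O searchStep s s' t [] ∧ SearchInv S d E s' ∧ t ≤ 24 ∧
      searchPotential S d E (s'.vars 6) (s'.vars 7) (s'.vars 8) (s'.vars 9) <
        searchPotential S d E (s.vars 6) (s.vars 7) (s.vars 8) (s.vars 9) := by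
  have hI' := hI
  obtain ⟨h0, h3, h5, h76, h8, h98, hP, hQ, hR, hM⟩ := hI
  have hlim : s.vars 8 < S.length - s.vars 6 := by
    unfold borderLimit at hb
    split_ifs at hb <;> omega
  have hrow := rowCost_eq_add S (x := s.vars 7) hb
  have hml := hM.le_matchLen h98
  by_cases hc : s.vars 9 < s.vars 8
  · have hsym := symEq_holds_iff (S := S) (s := s) (e := .add (.var 7) (.var 9))
      (f := .add (.sub (.add (.var 0) (.var 7)) (.add (.var 6) (.var 8))) (.var 9))
      (by simp only [Exp.eval]; omega)
    have hc' : (Test.lt (.var 9) (.var 8)).Holds S s := hc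
    by_cases hs : (Test.symEq (.add (.var 7) (.var 9))
      (.add (.sub (.add (.var 0) (.var 7)) (.add (.var 6) (.var 8))) (.var 9))).Holds S s
    · refine ⟨_, _, Exec.iteTrue hc' (Exec.iteTrue hs (Exec.assign 9 _ s ?_)), ?_, ?_, ?_⟩
      · simp only [Exp.eval]; omega
      all_goals rw [hsym] at hs; simp only [Exp.eval, h0] at hs
      all_goals
        have hM' : Match S (s.vars 7) (S.length + s.vars 7 - (s.vars 6 + s.vars 8))
            (s.vars 9 + 1) := fun k hk => by
          rcases (by omega : k < s.vars 9 ∨ k = s.vars 9) with hk | rfl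
          · exact hM k hk
          · exact hs
      · simp [SearchInv, Exp.eval]
        exact ⟨h0, h3, h5, h76, h8, hc, hP, hQ, hR, hM'⟩
      · simp [Exp.cost, Test.cost]
      · have := hM'.le_matchLen hc
        simp [Exp.eval, searchPotential]
        omega
    · refine ⟨_, _, Exec.iteTrue hc' (Exec.iteFalse hs (Exec.seq (Exec.assign 8 _ s ?_)
        (Exec.assign 9 _ _ ?_))), ?_, ?_, ?_⟩
      · simp only [Exp.eval]; omega
      · simp only [Exp.eval]; omega
      all_goals rw [hsym] at hs; simp only [Exp.eval, h0] at hs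
      · simp [SearchInv, Exp.eval]
        refine ⟨h0, h3, h5, h76, hP, hQ, fun l hl hl0 h => ?_, fun k hk => by omega⟩
        rcases (by omega : l < s.vars 8 ∨ l = s.vars 8) with hl | rfl
        · exact hR l hl hl0 h
        · exact hs (h _ hc)
      · simp [Exp.cost, Test.cost]
      · simp [Exp.eval, searchPotential]
        omega
  · have hc' : ¬ (Test.lt (.var 9) (.var 8)).Holds S s := hc
    have h9 : s.vars 9 = s.vars 8 := by omega
    rw [h9] at hM
    have hbord : Bordered S (s.vars 7) (S.length + s.vars 7 - s.vars 6) :=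
      ⟨s.vars 8, h8, by omega, hM.sub 0 rfl (by omega) (by omega)⟩
    by_cases hx : s.vars 7 < s.vars 6
    · have hx' : (Test.lt (.var 7) (.var 6)).Holds S s := hx
      refine ⟨_, _, Exec.iteFalse hc' (Exec.seq (Exec.iteTrue hx' (Exec.assign 7 _ s ?_))
        (Exec.seq (Exec.assign 8 _ _ ?_) (Exec.assign 9 _ _ ?_))), ?_, ?_, ?_⟩
      · simp only [Exp.eval]; omega
      · simp only [Exp.eval]; omega
      · simp only [Exp.eval]; omega
      · simp [SearchInv, Exp.eval]
        refine ⟨h0, h3, h5, by omega, hP, fun x hx => ?_, fun k hk => by omega⟩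
        rcases (by omega : x < s.vars 7 ∨ x = s.vars 7) with hx | rfl
        · exact hQ x hx
        · exact hbord
      · simp [Exp.cost, Test.cost]
      · simp [Exp.eval, searchPotential]
        have := levelCost_eq_add S (d := d) (E := E) (b := s.vars 6) (x := s.vars 7 + 1) (by omega)
        omega
    · have hx' : ¬ (Test.lt (.var 7) (.var 6)).Holds S s := hx
      have hP' : ∀ b' < s.vars 6 + 1, ∀ x ≤ b', Bordered S x (S.length + x - b') := by
        intro b' hb' x hxb
        rcases (by omega : b' < s.vars 6 ∨ b' = s.vars 6) with hb' | rfl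
        · exact hP b' hb' x hxb
        · rcases (by omega : x < s.vars 7 ∨ x = s.vars 7) with hx | rfl
          · exact hQ x hx
          · exact hbord
      have hB := le_length_sub_maxUnbordered hS hP'
      refine ⟨_, _, Exec.iteFalse hc' (Exec.seq (Exec.iteFalse hx' (Exec.seq
        (Exec.assign 6 _ s ?_) (Exec.assign 7 _ _ ?_)))
        (Exec.seq (Exec.assign 8 _ _ ?_) (Exec.assign 9 _ _ ?_))), ?_, ?_, ?_⟩
      · simp only [Exp.eval]; omega
      · simp only [Exp.eval]; omega
      · simp only [Exp.eval]; omega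
      · simp only [Exp.eval]; omega
      · simp [SearchInv, Exp.eval]
        exact ⟨h0, h3, h5, fun b' hb' => hP' b' (by omega), fun k hk => by omega⟩
      · simp [Exp.cost, Test.cost]
      · simp [Exp.eval, searchPotential]
        have h1 := levelCost_eq_add S (d := d) (E := E) (b := s.vars 6 + 1) (x := 0) (by omega)
        rw [← Finset.insert_Ioc_add_one_left_eq_Ioc (by omega : s.vars 6 <
          S.length - maxUnbordered S), Finset.sum_insert (by simp)]
        rw [Nat.zero_add] at h1
        omega

theorem exec_searchLoop (hS : S ≠ []) {d E : ℕ} (hW : S.length + 1 < W)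
    (hd : 2 * d < S.length)
    (hE : 0 < E → E = d + 1 ∧ S.length ≤ shortestPeriod (factor S d (S.length - d)) + 3 * d)
    (s : Store) (h0 : s.vars 0 = S.length) (h3 : s.vars 3 = d) (h5 : s.vars 5 = E)
    (h6 : s.vars 6 = 0) (h7 : s.vars 7 = 0) (h8 : s.vars 8 = 1) (h9 : s.vars 9 = 0) :
    ∃ s' t, Exec W S O (.loop searchTest searchStep) s s' t [] ∧ s'.vars 0 = S.length ∧
      s'.vars 6 = S.length - maxUnbordered S ∧ t ≤ 41 * searchCost S d E + 17 := by
  have hcost : searchTest.cost = 16 := by simp [searchTest, Test.cost, Exp.cost]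
  obtain ⟨s', t, hX, hI, hb, ht⟩ :=
    Exec.loop_of_potential (W := W) (S := S) (O := O) (b := searchTest) (P := searchStep)
      (SearchInv S d E)
      (fun s => 41 * searchPotential S d E (s.vars 6) (s.vars 7) (s.vars 8) (s.vars 9))
      (fun s hI hb => by
        obtain ⟨s', t, hX, hI', ht, hlt⟩ := exec_searchStep (W := W) (O := O) hS hW s hI
          ((searchTest_holds_iff hI).1 hb)
        exact ⟨s', t, hX, hI', by simp only [hcost]; omega⟩)
      s ⟨h0, h3, h5, by omega, by omega, by omega, fun b' hb' => by omega, fun x hx => by omega,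
        fun l hl hl0 => by omega, fun k hk => by omega⟩
  rw [searchTest_holds_iff hI, not_le] at hb
  obtain ⟨i0, i3, i5, i76, i8, i98, iP, iQ, iR, iM⟩ := hI
  have hB := le_length_sub_maxUnbordered hS iP
  have hpos := maxUnbordered_pos hS
  have hle := maxUnbordered_le_length S
  refine ⟨s', t, hX, i0, ?_, ?_⟩
  · have hu := not_bordered_of_limit hd hE i76 (by omega) hb iR
    have := le_maxUnbordered (by omega) (by omega) hu
    omega
  · simp only [h6, h7, h8, h9, searchPotential_zero, hcost] at ht
    exact ht

open Classical in
/-- The bound below which `searchStep` skips long borders: it is positive if the inner factor has no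
border of length greater than the margin `d`. -/
noncomputable def skipBound (w : List A) (d : ℕ) : ℕ :=
  if shortestPeriod (factor w d (w.length - d)) + 3 * d < w.length then 0 else d + 1

theorem runs_unborderedProg {n σ : ℕ} (hn : S.length = n) (h1 : 1 ≤ n) (hσ : 2 ≤ σ)
    (hW1 : n * σ < W) (hW2 : 210 * n < W) :
    ∃ t, RunsWithOneQuery W σ S shortestPeriod unborderedProg (margin n σ) (n - margin n σ)
        (maxUnbordered S) t ∧
      t ≤ 12 * Nat.clog σ n + 100 + 41 * searchCost S (margin n σ) (skipBound S (margin n σ)) := by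
  subst hn
  have hS : S ≠ [] := List.ne_nil_of_length_pos h1
  have hd := two_mul_margin_lt σ h1
  set d := margin S.length σ with hd_def
  have hv : ∀ x, (initStore S.length σ).vars x = if x = 0 then S.length else if x = 1 then σ else 0 :=
    fun x => rfl
  -- the logarithm
  have hX1 : Exec W S shortestPeriod (.assign 2 (.lit 1)) (initStore S.length σ) _ _ _ :=
    Exec.assign 2 (.lit 1) _ (by simp only [Exp.eval]; omega)
  obtain ⟨s2, t2, hX2, h23, h2x, ht2⟩ := exec_logLoop (W := W) (S := S) (O := shortestPeriod)
    (n := S.length) (σ := σ) hσ hW1 hW2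
    { (initStore S.length σ) with vars := Function.update (initStore S.length σ).vars 2 1 }
    (by simp [hv]) (by simp [hv]) (by simp) (by simp [hv])
  have h20 : s2.vars 0 = S.length := by rw [h2x 0 (by omega) (by omega)]; simp [hv]
  have h2z : ∀ x, 4 ≤ x → s2.vars x = 0 := fun x hx => by
    rw [h2x x (by omega) (by omega)]
    have : x ≠ 0 ∧ x ≠ 1 ∧ x ≠ 2 := by omega
    simp [hv, this]
  -- the margin
  obtain ⟨s3, t3, hX3, h33, h3x, ht3⟩ : ∃ s3 t3, Exec W S shortestPeriod
      (.ite (.lt (.mul (.lit 2) (.var 3)) (.var 0)) .skip (.assign 3 (.lit 0))) s2 s3 t3 [] ∧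
      s3.vars 3 = d ∧ (∀ x, x ≠ 3 → s3.vars x = s2.vars x) ∧ t3 ≤ 8 := by
    by_cases hc : 2 * (210 * Nat.clog σ S.length) < S.length
    · refine ⟨_, _, Exec.iteTrue (by simpa only [Test.Holds, Exp.eval, h20, h23] using hc)
        (Exec.skip s2), ?_, fun _ _ => rfl, by simp [Test.cost, Exp.cost]⟩
      rw [h23, hd_def, margin, if_pos hc]
    · refine ⟨_, _, Exec.iteFalse (by simpa only [Test.Holds, Exp.eval, h20, h23] using hc)
        (Exec.assign 3 (.lit 0) s2 (by simp only [Exp.eval]; omega)), ?_, fun x hx => by simp [hx],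
        by simp [Test.cost, Exp.cost]⟩
      simp [Exp.eval, hd_def, margin, if_neg hc]
  have h30 : s3.vars 0 = S.length := by rw [h3x 0 (by omega), h20]
  have h3z : ∀ x, 4 ≤ x → s3.vars x = 0 := fun x hx => by rw [h3x x (by omega), h2z x hx]
  -- the query
  set p := shortestPeriod (factor S d (S.length - d)) with hp
  have hlen := length_factor S (x := d) (e := S.length - d) (by omega)
  have hple : p ≤ S.length := by
    have := shortestPeriod_le_length (w := factor S d (S.length - d))
      (List.ne_nil_of_length_pos (by omega))
    omega
  have hX4 : Exec W S shortestPeriod (.query 4 (.var 3) (.sub (.var 0) (.var 3))) s3 _ _ _ :=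
    Exec.query 4 (.var 3) (.sub (.var 0) (.var 3)) s3 (by simp only [Exp.eval, h30, h33]; omega)
      (by simp only [Exp.eval, h30, h33]; omega) (by simp only [Exp.eval, h30, h33]; omega)
  simp only [Exp.eval, h30, h33, ← hp] at hX4
  -- the bound below which long borders are skipped
  obtain ⟨s5, t5, hX5, h55, h5x, ht5⟩ : ∃ s5 t5, Exec W S shortestPeriod
      (.ite (.lt (.add (.var 4) (.mul (.lit 3) (.var 3))) (.var 0)) .skip
        (.assign 5 (.add (.var 3) (.lit 1)))) { s3 with vars := Function.update s3.vars 4 p }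
        s5 t5 [] ∧
      s5.vars 5 = skipBound S d ∧ (∀ x, x ≠ 4 → x ≠ 5 → s5.vars x = s3.vars x) ∧ t5 ≤ 20 := by
    by_cases hc : p + 3 * d < S.length
    · refine ⟨_, _, Exec.iteTrue ?_ (Exec.skip _), ?_, fun x hx _ => by simp [hx],
        by simp [Test.cost, Exp.cost]⟩
      · simpa [Test.Holds, Exp.eval, h30, h33] using hc
      · rw [skipBound, if_pos hc]
        simp [h3z]
    · refine ⟨_, _, Exec.iteFalse ?_ (Exec.assign 5 _ _ ?_), ?_, fun x hx hx' => by simp [hx, hx'],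
        by simp [Test.cost, Exp.cost]⟩
      · simpa [Test.Holds, Exp.eval, h30, h33] using hc
      · simp [Exp.eval, h33]; omega
      · rw [skipBound, if_neg hc]
        simp [Exp.eval, h33]
  have h5z : ∀ x, 6 ≤ x → s5.vars x = 0 := fun x hx => by
    rw [h5x x (by omega) (by omega), h3z x (by omega)]
  -- the search
  have hX6 : Exec W S shortestPeriod (.assign 8 (.lit 1)) s5 _ _ _ :=
    Exec.assign 8 (.lit 1) _ (by simp only [Exp.eval]; omega)
  obtain ⟨s7, t7, hX7, h70, h76, ht7⟩ := exec_searchLoop (W := W) (O := shortestPeriod) hS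
    (d := d) (E := skipBound S d) (by omega) hd
    (fun h => by
      unfold skipBound at h ⊢
      split_ifs at h ⊢ with hc
      · omega
      · exact ⟨rfl, by omega⟩)
    { s5 with vars := Function.update s5.vars 8 1 }
    (by simp [h5x, h30]) (by simp [h5x, h33]) (by simp [h55])
    (by simp [h5z]) (by simp [h5z]) (by simp) (by simp [h5z])
  refine ⟨_, ⟨_, Exec.seq hX1 (Exec.seq hX2 (Exec.seq hX3 (Exec.seq hX4 (Exec.seq hX5
    (Exec.seq hX6 (Exec.seq hX7 (Exec.assign 0 _ _ ?_))))))), ?_⟩, ?_⟩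
  · simp only [Exp.eval]; omega
  · have := maxUnbordered_le_length S
    simp [Exp.eval, h70, h76]
    omega
  · simp only [Exp.cost]
    omega

end RAM

/-! ### Expected running times -/

open Str RAM

/-- The number `5460 = 420 * 13` is the largest `n` with `n ≤ 420 ⌈log₂ n⌉`. -/
theorem margin_cases {n σ : ℕ} (hσ : 2 ≤ σ) :
    margin n σ = 210 * Nat.clog σ n ∨ n ≤ 5460 := by
  unfold margin
  split_ifs with h
  · exact Or.inl rfl
  right
  have h1 : Nat.clog σ n ≤ Nat.clog 2 n := Nat.clog_anti_left (by norm_num) hσ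
  by_contra hn
  have h2 : 2 ^ (Nat.clog 2 n - 1) < n := Nat.pow_pred_clog_lt_self (by norm_num) (by omega)
  have h3 : ∀ k : ℕ, 420 * (k + 14) < 2 ^ (k + 13) := by
    intro k
    induction k with
    | zero => norm_num
    | succ k ih => rw [show k + 1 + 13 = (k + 13) + 1 by omega, pow_succ]; omega
  rcases le_or_gt (Nat.clog 2 n) 13 with h4 | h4
  · omega
  · have h5 := h3 (Nat.clog 2 n - 14)
    rw [show Nat.clog 2 n - 14 + 13 = Nat.clog 2 n - 1 by omega] at h5
    omega

theorem clog_le_one_add_logb {n σ : ℕ} (hσ : 2 ≤ σ) (hn : 1 ≤ n) :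
    (Nat.clog σ n : ℝ) ≤ 1 + Real.logb σ n := by
  have hσ' : (1 : ℝ) < σ := by exact_mod_cast hσ
  rcases hn.eq_or_lt with rfl | hn
  · simp
  have h := Nat.pow_pred_clog_lt_self (b := σ) (by omega) hn
  have h1 : ((Nat.clog σ n - 1 : ℕ) : ℝ) ≤ Real.logb σ n := by
    rw [Real.le_logb_iff_rpow_le hσ' (by positivity), Real.rpow_natCast]
    exact_mod_cast h.le
  have h2 : (Nat.clog σ n : ℝ) ≤ ((Nat.clog σ n - 1 : ℕ) : ℝ) + 1 := by
    exact_mod_cast (by omega : Nat.clog σ n ≤ Nat.clog σ n - 1 + 1)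
  linarith

theorem uniformMean_eq_mean {A : Type u} [Fintype A] {n : ℕ} (T : (Fin n → A) → ℕ) :
    uniformMean n T = mean fun S => (T S : ℝ) := rfl

/-- The search compares `O(d)` symbols on average. The exhaustive search, which is needed if
`|S| - L(S) > d` or if the inner factor has a border of length greater than `d`, takes time
`O(n ^ 4)`; both events have probability `O(n ^ (-4))`. -/
theorem exists_mean_searchCost_le : ∃ C : ℝ, 0 ≤ C ∧ ∀ (A : Type u) [Fintype A] (n : ℕ),
    2 ≤ Fintype.card A → 1 ≤ n →
    mean (fun S : Fin n → A => (searchCost (List.ofFn S) (margin n (Fintype.card A))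
      (skipBound (List.ofFn S) (margin n (Fintype.card A))) : ℝ)) ≤
      C * (1 + Nat.clog (Fintype.card A) n) := by
  obtain ⟨C, hC, hmean⟩ := exists_mean_cube_le.{u}
  refine ⟨630 * C + 2520 + 5460 ^ 4, by positivity, fun A _ n hA hn => ?_⟩
  classical
  have hq0 : (0 : ℝ) ≤ Nat.clog (Fintype.card A) n := Nat.cast_nonneg _
  rcases margin_cases (n := n) hA with hd | hsmall
  · set d := margin n (Fintype.card A) with hd_def
    set q := Nat.clog (Fintype.card A) n with hq
    have h2d : 2 * d < n := two_mul_margin_lt _ hn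
    -- the second summand pays for the exhaustive search
    have hpt : ∀ S : Fin n → A, (searchCost (List.ofFn S) d (skipBound (List.ofFn S) d) : ℝ) ≤
        (3 * d * ((n - maxUnbordered (List.ofFn S) + 1 : ℕ) : ℝ) ^ 3 +
          excessCost (List.ofFn S) d) +
        (n : ℝ) ^ 4 * ((if d < n - maxUnbordered (List.ofFn S) then 1 else 0) +
          (if shortestPeriod (factor (List.ofFn S) d (n - d)) + 3 * d < n then 1 else 0)) := by
      intro S
      have hlen : (List.ofFn S).length = n := List.length_ofFn
      have hpow : (searchCost (List.ofFn S) d (skipBound (List.ofFn S) d) : ℝ) ≤ (n : ℝ) ^ 4 := by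
        have := searchCost_le_pow (List.ofFn S) d (skipBound (List.ofFn S) d)
        rw [hlen] at this
        exact_mod_cast this
      have hnn : (0 : ℝ) ≤ 3 * d * ((n - maxUnbordered (List.ofFn S) + 1 : ℕ) : ℝ) ^ 3 +
          excessCost (List.ofFn S) d := by positivity
      have hn4 : (0 : ℝ) ≤ (n : ℝ) ^ 4 := by positivity
      by_cases h1 : d < n - maxUnbordered (List.ofFn S)
      · rw [if_pos h1]
        split_ifs <;> linarith
      by_cases h2 : shortestPeriod (factor (List.ofFn S) d (n - d)) + 3 * d < n
      · rw [if_pos h2, if_neg h1]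
        linarith
      · rw [if_neg h1, if_neg h2, skipBound, hlen, if_neg h2, add_zero, mul_zero, add_zero]
        have := searchCost_le (List.ofFn S) (d := d) (by rw [hlen]; omega)
        rw [hlen] at this
        exact_mod_cast this
    -- `n ^ 4` is absorbed by the probabilities
    have hsmall : (n : ℝ) ^ 4 * (1 / (Fintype.card A : ℝ)) ^ (5 * q) ≤ 1 := by
      have hle : (n : ℝ) ≤ (Fintype.card A : ℝ) ^ q := by
        exact_mod_cast Nat.le_pow_clog (b := Fintype.card A) (by omega) n
      have hA1 : (1 : ℝ) ≤ Fintype.card A := by exact_mod_cast (by omega : 1 ≤ Fintype.card A)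
      rw [one_div, inv_pow, ← div_eq_mul_inv, div_le_one (by positivity)]
      calc (n : ℝ) ^ 4 ≤ ((Fintype.card A : ℝ) ^ q) ^ 4 := by gcongr
        _ = (Fintype.card A : ℝ) ^ (4 * q) := by rw [← pow_mul, Nat.mul_comm]
        _ ≤ _ := pow_le_pow_right₀ hA1 (by omega)
    have hP1 : prob (fun S : Fin n → A => d < n - maxUnbordered (List.ofFn S)) ≤
        34 * (1 / (Fintype.card A : ℝ)) ^ (5 * q) := by
      have := prob_tail_le (n := n) hA d
      rwa [show d / 42 = 5 * q by omega] at this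
    have hP2 : prob (fun S : Fin n → A =>
        shortestPeriod (factor (List.ofFn S) d (n - d)) + 3 * d < n) ≤
        (1 / (Fintype.card A : ℝ)) ^ (5 * q) := by
      refine (prob_shortestPeriod_factor_lt hA h2d).trans ?_
      exact pow_le_pow_of_le_one (by positivity) ((one_div_card_le hA).trans (by norm_num))
        (by omega)
    have hmean1 := hmean A n hA
    have hmean2 := mean_excessCost_le (n := n) hA d
    have hdq : (d : ℝ) = 210 * q := by exact_mod_cast hd
    have hmean3 : mean (fun S : Fin n → A => (searchCost (List.ofFn S) d
        (skipBound (List.ofFn S) d) : ℝ)) ≤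
        (3 * d * mean (fun S : Fin n → A => ((n - maxUnbordered (List.ofFn S) + 1 : ℕ) : ℝ) ^ 3) +
          mean (fun S : Fin n → A => (excessCost (List.ofFn S) d : ℝ))) +
        (n : ℝ) ^ 4 * (prob (fun S : Fin n → A => d < n - maxUnbordered (List.ofFn S)) +
          prob (fun S : Fin n → A =>
            shortestPeriod (factor (List.ofFn S) d (n - d)) + 3 * d < n)) := by
      refine (mean_mono hpt).trans_eq ?_
      rw [mean_add, mean_add, mean_mul_left, mean_mul_left, mean_add]
      unfold prob
      congr!
    calc _ ≤ _ := hmean3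
      _ ≤ (3 * d * C + 12 * d) + (n : ℝ) ^ 4 * (34 * (1 / (Fintype.card A : ℝ)) ^ (5 * q) +
          (1 / (Fintype.card A : ℝ)) ^ (5 * q)) := by gcongr
      _ = (630 * C + 2520) * q +
          35 * ((n : ℝ) ^ 4 * (1 / (Fintype.card A : ℝ)) ^ (5 * q)) := by rw [hdq]; ring
      _ ≤ (630 * C + 2520) * q + 35 * 1 := by gcongr
      _ ≤ _ := by nlinarith
  · calc _ ≤ mean (fun _ : Fin n → A => (5460 : ℝ) ^ 4) := by
          refine mean_mono fun S => ?_
          have := searchCost_le_pow (List.ofFn S) (margin n (Fintype.card A))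
            (skipBound (List.ofFn S) (margin n (Fintype.card A)))
          rw [List.length_ofFn] at this
          exact_mod_cast this.trans (Nat.pow_le_pow_left hsmall 4)
      _ = (5460 : ℝ) ^ 4 := mean_const hA _
      _ ≤ _ := by nlinarith

theorem word_bound {n σ : ℕ} (hσ : 2 ≤ σ) (hn : 1 ≤ n) :
    n * σ < (n + σ) ^ 8 ∧ 210 * n < (n + σ) ^ 8 := by
  have h3 : 3 ^ 6 ≤ (n + σ) ^ 6 := Nat.pow_le_pow_left (by omega) 6
  have h8 : (n + σ) ^ 8 = (n + σ) ^ 6 * ((n + σ) * (n + σ)) := by ring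
  rw [h8]
  constructor <;> nlinarith

theorem theorem2 :
    -- (a) from `L(S)` to `per(S')` for a fixed factor `S'` of `S`
    (∃ (P : RAM.Prog) (k : ℕ) (C : ℝ) (i j : ℕ → ℕ → ℕ), ∀ (A : Type u) [Fintype A] (n : ℕ),
      2 ≤ Fintype.card A → 1 ≤ n →
      i n (Fintype.card A) < j n (Fintype.card A) ∧ j n (Fintype.card A) ≤ n ∧
      ∃ T : (Fin n → A) → ℕ,
        (∀ S : Fin n → A,
          RAM.RunsWithOneQuery ((n + Fintype.card A) ^ k) (Fintype.card A) (List.ofFn S)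
            Str.shortestPeriod P (i n (Fintype.card A)) (j n (Fintype.card A))
            (Str.maxUnbordered (List.ofFn S)) (T S)) ∧
        uniformMean n T ≤ C * (1 + Real.logb (Fintype.card A) n)) ∧
    -- (b) from `per(S)` to `L(S)`
    (∃ (P : RAM.Prog) (k : ℕ) (C : ℝ), ∀ (A : Type u) [Fintype A] (n : ℕ),
      2 ≤ Fintype.card A → 1 ≤ n →
      ∃ T : (Fin n → A) → ℕ,
        (∀ S : Fin n → A,
          RAM.RunsWithOneQuery ((n + Fintype.card A) ^ k) (Fintype.card A) (List.ofFn S)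
            Str.maxUnbordered P 0 n (Str.shortestPeriod (List.ofFn S)) (T S)) ∧
        uniformMean n T ≤ C) ∧
    -- (c) the combinatorial core of (a)
    (∀ (A : Type u) (S : List A) (d : ℕ), 6 * d < S.length →
      ∀ Sbar S' Sbar' : List A,
        Sbar = Str.factor S 0 (3 * d) ++ Str.factor S (S.length - 3 * d) S.length →
        S' = Str.factor S d (S.length - d) →
        Sbar' = Str.factor S d (3 * d) ++ Str.factor S (S.length - 3 * d) (S.length - d) →
        (Sbar.length : ℤ) - Str.maxUnbordered Sbar ≤ d →
        (S'.length : ℤ) - Str.shortestPeriod S' ≤ d →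
        (Sbar'.length : ℤ) - Str.shortestPeriod Sbar' ≤ d →
        (S.length : ℤ) - Str.maxUnbordered S = (Sbar.length : ℤ) - Str.maxUnbordered Sbar) ∧
    -- (d) the sentinel construction behind (b)
    (∀ (A : Type u) (S : List A), S ≠ [] →
      ∀ Ssent : List (Option A),
        Ssent = Str.withSentinel S (S.length - Str.maxUnbordered S) →
        (S.length : ℤ) - Str.shortestPeriod S =
          (Ssent.length : ℤ) - Str.shortestPeriod Ssent) := by
  refine ⟨?_, ?_, ?_, ?_⟩
  · obtain ⟨C, hC, hmean⟩ := exists_mean_searchCost_le.{u}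
    refine ⟨unborderedProg, 8, 2 * (112 + 41 * C), margin, fun n σ => n - margin n σ, ?_⟩
    intro A _ n hA hn
    have hd := two_mul_margin_lt (Fintype.card A) hn
    refine ⟨by dsimp only; omega, Nat.sub_le _ _, ?_⟩
    obtain ⟨hW1, hW2⟩ := word_bound hA hn
    choose T hT hTle using fun S : Fin n → A => runs_unborderedProg (S := List.ofFn S)
      (W := (n + Fintype.card A) ^ 8) (n := n) (σ := Fintype.card A) (by simp) hn hA hW1 hW2
    refine ⟨T, hT, ?_⟩
    set q := Nat.clog (Fintype.card A) n with hq
    have hq0 : (0 : ℝ) ≤ q := Nat.cast_nonneg _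
    have hlog := clog_le_one_add_logb hA hn
    have hlog0 : 0 ≤ Real.logb (Fintype.card A) n :=
      Real.logb_nonneg (by exact_mod_cast hA) (by exact_mod_cast hn)
    rw [uniformMean_eq_mean]
    calc mean (fun S => (T S : ℝ)) ≤ mean (fun S : Fin n → A => (12 * (q : ℝ) + 100) +
          41 * (searchCost (List.ofFn S) (margin n (Fintype.card A))
            (skipBound (List.ofFn S) (margin n (Fintype.card A))) : ℝ)) :=
          mean_mono fun S => by exact_mod_cast hTle S
      _ ≤ (12 * (q : ℝ) + 100) + 41 * (C * (1 + q)) := by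
          rw [mean_add, mean_const hA, mean_mul_left]
          have := hmean A n hA hn
          gcongr
      _ ≤ (112 + 41 * C) * (1 + q) := by nlinarith
      _ ≤ (112 + 41 * C) * (2 * (1 + Real.logb (Fintype.card A) n)) := by gcongr; linarith
      _ = _ := by ring
  · obtain ⟨C, hC, hmean⟩ := exists_mean_cube_le.{u}
    refine ⟨periodProg, 8, 40 * C, ?_⟩
    intro A _ n hA hn
    obtain ⟨hW1, hW2⟩ := word_bound hA hn
    choose T hT hTle using fun S : Fin n → A => runs_periodProg (S := List.ofFn S)
      (W := (n + Fintype.card A) ^ 8) (n := n) (σ := Fintype.card A) (by simp) hn (by omega)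
    refine ⟨T, hT, ?_⟩
    rw [uniformMean_eq_mean]
    calc mean (fun S => (T S : ℝ)) ≤ mean (fun S : Fin n → A =>
          40 * ((n - maxUnbordered (List.ofFn S) + 1 : ℕ) : ℝ) ^ 3) := by
          refine mean_mono fun S => ?_
          have h2 := Nat.pow_le_pow_right (n := n - maxUnbordered (List.ofFn S) + 1)
            (by omega) (show 2 ≤ 3 by norm_num)
          have := (hTle S).trans (Nat.mul_le_mul_left 40 h2)
          exact_mod_cast this
      _ ≤ _ := by
          rw [mean_mul_left]
          have := hmean A n hA
          gcongr
  · exact fun A S d hd Sbar S' Sbar' h1 h2 h3 h4 h5 h6 =>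
      length_sub_maxUnbordered_eq S d hd Sbar S' Sbar' h1 h2 h3 h4 h5 h6
  · rintro A S hS _ rfl
    exact length_sub_shortestPeriod_eq S hS
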